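/- Let $q$ be a power of a prime $p$, let $m\ge 1$ and $\delta$ be integers with $2\le\delta\le q^m-1$, and put $n=q^{2m}-1$ and $\delta_{\max}=q^{m+[m\text{ even}]}-1-(q^2-2)[m\text{ even}]$, where $[P]=1$ if $P$ holds and $[P]=0$ otherwise. Let $\alpha$ be a primitive element of $\mathbf F_{q^{2m}}$ and let $C=\mathcal{BCH}(n,q^2;\delta)$ be the primitive, narrow-sense BCH code, i.e. the cyclic code of length $n$ over $\mathbf F_{q^2}$ with generator polynomial $\prod_{z\in Z}(x-\alpha^z)$, where $Z=C_1\cup\dots\cup C_{\delta-1}$ and $C_x=\{xq^{2k}\bmod n : 0\le k<m\}$. Let $C^{\perp_h}=\{y\in\mathbf F_{q^2}^n : \sum_i y_i^q x_i=0\text{ for all }x\in C\}$ be its Hermitian dual. On $\mathbf C^{q^n}$, with orthonormal basis $|x\rangle$, $x\in\mathbf F_q^n$, define for $a,b\in\mathbf F_q^n$ the error operator $E(a,b)|x\rangle=e^{2\pi i\,\mathrm{tr}(b\cdot x)/p}|x+a\rangle$, where $\mathrm{tr}$ is the trace $\mathbf F_q\to\mathbf F_p$; its weight is the number of $i$ with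 $(a_i,b_i)\ne(0,0)$. The stabilizer group of a subspace $Q$ is the group of all $cE(a,b)$, $|c|=1$, that fix every vector of $Q$. A stabilizer code is a nonzero subspace $Q$ that equals the joint $1$-eigenspace of its stabilizer group. It has parameters $[[n,k,d_Q]]_q$ if $\dim Q=q^k$ and $d_Q$ is the largest integer $d$ such that for every $E(a,b)$ of weight less than $d$ there is a scalar $c$ with $\langle u|E(a,b)|v\rangle=c\langle u|v\rangle$ for all $u,v\in Q$. It is pure up to $t$ if its stabilizer group contains no non-scalar operator of weight less than $t$, and pure if it is pure up to $d_Q$. Then $C^{\perp_h}\subseteq C$, and there is a stabilizer code $Q$ with parameters $$[[\,q^{2m}-1,\ q^{2m}-1-2m\lceil(\delta-1)(1-1/q^2)\rceil,\ d_Q\,]]_q,\qquad d_Q\ge\delta,$$ that is pure up to $\delta_{\max}+1$ and is obtained from $C$ by the Hermitian construction: for some $\beta\in\mathbf F_{q^2}$ such that $(\beta,\beta^q)$ is a basis of $\mathbf F_{q^2}$ over $\mathbf F_q$, a scalar multiple of $E(a,b)$ lies in the stabilizer group of $Q$ if and only if $\beta a+\beta^q b\in C^{\perp_h}$. Moreover,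 if the true minimum distance $d$ of $C$ satisfies $d\le\delta_{\max}$, then $Q$ is pure and $d_Q=d$. -/

import Mathlib

noncomputable section

namespace QuantumBCH

/-! ### Classical codes -/

/-- The `Q`-ary cyclotomic coset `C_x = {x Q^k mod n | 0 ≤ k < m}` of `x` modulo `n`. -/
def cyclotomicCoset (n Q m x : ℕ) : Finset ℕ :=
  (Finset.range m).image fun k => x * Q ^ k % n

/-- The defining set `Z = C_1 ∪ ⋯ ∪ C_{δ-1}`. -/
def definingSet (n Q m δ : ℕ) : Finset ℕ :=
  (Finset.Icc 1 (δ - 1)).biUnion fun x => cyclotomicCoset n Q m x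

/-- The generator polynomial `g(X) = ∏_{z ∈ Z} (X - α^z)`, for `α` in the extension field `L`. -/
def generatorPoly {L : Type*} [Field L] (n Q m δ : ℕ) (α : L) : Polynomial L :=
  ∏ z ∈ definingSet n Q m δ, (Polynomial.X - Polynomial.C (α ^ z))

/-- The polynomial `c_0 + c_1 X + ⋯ + c_{n-1} X^{n-1}` of a word `c` over `K`, with coefficients
read in the extension field `L`. -/
def wordPoly {K : Type*} (L : Type*) [Field K] [Field L] [Algebra K L] {n : ℕ}
    (c : Fin n → K) : Polynomial L :=
  ∑ i, Polynomial.C (algebraMap K L (c i)) * Polynomial.X ^ (i : ℕ)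

/-- The primitive, narrow-sense BCH code of length `n = Q^m - 1` over the field `K` with `Q`
elements and of designed distance `δ`, with respect to the primitive element `α` of the field `L`
with `Q^m` elements: the cyclic code generated by `g`, that is, the set of the words over `K` of
length `n` whose polynomial is a multiple of `g`.  (As `g` has coefficients in `K`, divisibility
over `K` and over `L` are the same.) -/
def bchCode (K : Type*) {L : Type*} [Field K] [Field L] [Algebra K L] (n Q m δ : ℕ) (α : L) :
    Submodule K (Fin n → K) where
  carrier := {c | generatorPoly n Q m δ α ∣ wordPoly L c}
  zero_mem' := by simp [wordPoly]
  add_mem' := by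
    intro a b ha hb
    have h : wordPoly L (a + b) = wordPoly L a + wordPoly L b := by
      simp [wordPoly, add_mul, Finset.sum_add_distrib]
    simpa only [Set.mem_ofPred_eq, h] using dvd_add ha hb
  smul_mem' := by
    intro r a ha
    have h : wordPoly L (r • a) = Polynomial.C (algebraMap K L r) * wordPoly L a := by
      simp [wordPoly, Finset.mul_sum, mul_assoc]
    simpa only [Set.mem_ofPred_eq, h] using Dvd.dvd.mul_left ha _

/-- `d` is the (true) minimum distance of the code `C`. -/
def IsCodeMinDist {K : Type*} [DecidableEq K] {n : ℕ} (C : Set (Fin n → K)) (d : ℕ) : Prop :=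
  IsLeast {w | ∃ x ∈ C, ∃ y ∈ C, x ≠ y ∧ hammingDist x y = w} d

/-- The Hermitian dual `{y | y^q · x = 0 for all x ∈ C}` of a code over a field with `q^2`
elements. -/
def hermitianDual {K : Type*} [Field K] {n : ℕ} (q : ℕ) (C : Set (Fin n → K)) :
    Set (Fin n → K) :=
  {y | ∀ x ∈ C, ∑ i, y i ^ q * x i = 0}

/-! ### Quantum codes

`F` is a finite field of characteristic `p`.  The state space of `n` qudits is `ℂ^(q^n)`, with
orthonormal basis `|x⟩` for `x ∈ F^n`. -/

/-- The state space of `n` qudits with levels indexed by `F`. -/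
abbrev StateSpace (F : Type*) [Fintype F] (n : ℕ) : Type _ :=
  EuclideanSpace ℂ (Fin n → F)

section

variable (p : ℕ) [Fact p.Prime] {F : Type*} [Field F] [Fintype F] [DecidableEq F]
  [Algebra (ZMod p) F] {n : ℕ}

/-- The additive character `x ↦ exp(2πi tr(x)/p)` of `F`, where `tr` is the absolute trace. -/
def phase (x : F) : ℂ :=
  ZMod.stdAddChar (Algebra.trace (ZMod p) F x)

/-- The operator `X(a)|x⟩ = |x + a⟩`. -/
def shiftOp (a : Fin n → F) : StateSpace F n →ₗ[ℂ] StateSpace F n where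
  toFun v := WithLp.toLp 2 fun y => v (y - a)
  map_add' u v := by ext y; simp
  map_smul' c v := by ext y; simp

/-- The operator `Z(b)|x⟩ = exp(2πi tr(b·x)/p)|x⟩`. -/
def phaseOp (b : Fin n → F) : StateSpace F n →ₗ[ℂ] StateSpace F n where
  toFun v := WithLp.toLp 2 fun y => phase p (b ⬝ᵥ y) * v y
  map_add' u v := by ext y; simp [mul_add]
  map_smul' c v := by ext y; simp [mul_left_comm]

/-- The error operator `E(a,b) = X(a) Z(b)`. -/
def errorOp (a b : Fin n → F) : StateSpace F n →ₗ[ℂ] StateSpace F n :=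
  shiftOp a ∘ₗ phaseOp p b

/-- The weight of `E(a,b)`: the number of qudits on which it is not a scalar, i.e. the number of
`i` with `(a_i, b_i) ≠ (0, 0)`. -/
def errorWeight (a b : Fin n → F) : ℕ :=
  hammingNorm fun i => (a i, b i)

/-- The error group: the operators `c E(a,b)` with a phase factor `|c| = 1`. -/
def errorGroup (F : Type*) [Field F] [Fintype F] [Algebra (ZMod p) F] (n : ℕ) :
    Set (StateSpace F n →ₗ[ℂ] StateSpace F n) :=
  {T | ∃ (c : ℂ) (a b : Fin n → F), ‖c‖ = 1 ∧ T = c • errorOp p a b}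

/-- The stabilizer group of a quantum code `Q`: the elements of the error group that fix every
vector of `Q`. -/
def stabilizer (Q : Submodule ℂ (StateSpace F n)) :
    Set (StateSpace F n →ₗ[ℂ] StateSpace F n) :=
  {T | T ∈ errorGroup p F n ∧ ∀ v ∈ Q, T v = v}

/-- `Q` is a stabilizer code: a nonzero subspace that equals the joint eigenspace, for the
eigenvalue `1`, of its stabilizer group. -/
def IsStabilizerCode (Q : Submodule ℂ (StateSpace F n)) : Prop :=
  Q ≠ ⊥ ∧ ∀ v, v ∈ Q ↔ ∀ T ∈ stabilizer p Q, T v = v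

/-- `Q` detects every error of weight less than `d`: for each such error `E` there is a scalar
`c` with `⟨u|E|v⟩ = c⟨u|v⟩` for all `u, v ∈ Q`. -/
def DetectsBelow (Q : Submodule ℂ (StateSpace F n)) (d : ℕ) : Prop :=
  ∀ a b : Fin n → F, errorWeight a b < d →
    ∃ c : ℂ, ∀ u ∈ Q, ∀ v ∈ Q, inner ℂ u (errorOp p a b v) = c * inner ℂ u v

/-- `d` is the minimum distance of the quantum code `Q` (of dimension at least two): the largest
`d` such that `Q` detects every error of weight less than `d`. -/
def IsQuantumMinDist (Q : Submodule ℂ (StateSpace F n)) (d : ℕ) : Prop :=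
  IsGreatest {e | DetectsBelow p Q e} d

/-- The stabilizer code `Q` is pure up to `t`: its stabilizer group contains no non-scalar
operator of weight less than `t`. -/
def IsPureUpTo (Q : Submodule ℂ (StateSpace F n)) (t : ℤ) : Prop :=
  ∀ (c : ℂ) (a b : Fin n → F), c • errorOp p a b ∈ stabilizer p Q → (a ≠ 0 ∨ b ≠ 0) →
    t ≤ (errorWeight a b : ℤ)

/-- `Q` is a stabilizer code with parameters `[[n, k, d]]_q`, where `q` is the number of elements
of `F`: its dimension is `q^k` and its minimum distance is `d`. -/
structure HasParameters (Q : Submodule ℂ (StateSpace F n)) (k d : ℕ) : Prop where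
  isStabilizerCode : IsStabilizerCode p Q
  finrank_eq : Module.finrank ℂ Q = Fintype.card F ^ k
  isQuantumMinDist : IsQuantumMinDist p Q d

/-- `Q` is obtained by the Hermitian construction from the code `C` over the quadratic extension
`K` of `F`: with respect to some normal basis `(β, β^q)` of `K` over `F`, the operators `E(a,b)`
that belong, up to a phase, to the stabilizer group of `Q` are exactly those for which the word
`β a + β^q b` lies in the Hermitian dual of `C`. -/
def IsHermitianConstruction {K : Type*} [Field K] [Algebra F K]
    (Q : Submodule ℂ (StateSpace F n)) (C : Set (Fin n → K)) : Prop :=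
  ∃ β : K, LinearIndependent F ![β, β ^ Fintype.card F] ∧
    ∀ a b : Fin n → F, (∃ c : ℂ, c • errorOp p a b ∈ stabilizer p Q) ↔
      (fun i => β * algebraMap F K (a i) + β ^ Fintype.card F * algebraMap F K (b i)) ∈
        hermitianDual (Fintype.card F) C

end

/-- `δ_max = q^(m + [m even]) - 1 - (q^2 - 2)[m even]`. -/
def deltaMax (q m : ℕ) : ℤ :=
  (q : ℤ) ^ (m + if Even m then 1 else 0) - 1 - ((q : ℤ) ^ 2 - 2) * if Even m then 1 else 0

end QuantumBCH

end

/-!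
The Hermitian construction turns a code `C` over `K = 𝔽_{q²}` that contains its Hermitian dual
into a stabilizer code: after the choice of a normal basis `(β, β^q)`, the Hermitian dual becomes
a group `D` of labels `(a, b)`, isotropic for the trace-symplectic form, whose symplectic
complement consists of the labels of `C` (`isOrthogonalTo_hermitianLabels_iff`).

For an isotropic group `D` the operators `E(d)`, `d ∈ D`, commute, and so they have a common
eigenvector. Dividing each by its eigenvalue there gives a lift of `D` to a group of operators
with a nonzero joint fixed space `Q` (`IsIsotropic.exists_isPhaseLift`). The average of this group
is the projection onto `Q`. As the nontrivial error operators are traceless, its trace gives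
`dim Q = q^n / |D|` (`IsPhaseLift.finrank_mul_card`), and the same computation shows that only the
labels in `D` act on `Q` as scalars (`IsPhaseLift.mem_of_forall_eq_smul`). An error that fails to
commute with some `E(d)` maps `Q` to an orthogonal space, so the undetectable errors are those
with labels in the complement of `D` but outside of `D` (`IsPhaseLift.detectsBelow_iff`). Thus the
minimum distance is the least weight in `C` outside of the Hermitian dual, and purity is a matter
of the weights in the Hermitian dual (`exists_hermitianConstruction`).

For the BCH code, the words of the Hermitian dual are orthogonal to all trace words
`(Tr(κ α^{q s i}))_i` that lie in `C`, and therefore vanish at `α^s` unless `-q s` is in the defining set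
(`syndrome_eq_zero_of_mem_hermitianDual`). A size estimate, `not_dvd_add_mul_pow`, shows that this
never happens for `0 ≤ s < δ_max`. As `δ ≤ δ_max`, the Hermitian dual is contained in `C`, and by
the BCH bound its nonzero words have weight greater than `δ_max`. The inclusion is strict, since
the all-ones word lies in `C` and has Hermitian square `n = -1`. The dimension of `C` comes from
the independence of the syndromes at representatives of the cyclotomic cosets, for which an
inverse Fourier transform made of trace words is given (`exists_syndrome_eq`).
-/

namespace QuantumBCH

open Module

/-! ### Error operators -/

section ErrorOperators

variable (p : ℕ) [Fact p.Prime] {F : Type*} [Field F] [Algebra (ZMod p) F] {n : ℕ}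

theorem phase_zero : phase p (0 : F) = 1 := by
  simp [phase]

theorem phase_add (x y : F) : phase p (x + y) = phase p x * phase p y := by
  simp [phase, AddChar.map_add_eq_mul]

theorem norm_phase (x : F) : ‖phase p x‖ = 1 := by
  rw [phase, ZMod.stdAddChar_apply, Circle.norm_coe]

theorem phase_ne_zero (x : F) : phase p x ≠ 0 := by
  intro h
  simpa [h] using norm_phase p x

theorem phase_eq_one_iff (x : F) : phase p x = 1 ↔ Algebra.trace (ZMod p) F x = 0 := by
  rw [phase, ← (ZMod.stdAddChar (N := p)).map_zero_eq_one,
    ZMod.injective_stdAddChar.eq_iff]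

variable [Fintype F]

/-- The pairing `(x, y) ↦ phase (x * y)` is nondegenerate, since the trace form of `F` over its
prime field is. -/
theorem eq_zero_of_forall_phase_mul {x : F} (h : ∀ y : F, phase p (x * y) = 1) : x = 0 := by
  apply (traceForm_nondegenerate (ZMod p) F).1 x
  intro y
  rw [Algebra.traceForm_apply]
  exact (phase_eq_one_iff p _).1 (h y)

theorem errorOp_apply (a b : Fin n → F) (v : StateSpace F n) (y : Fin n → F) :
    errorOp p a b v y = phase p (b ⬝ᵥ (y - a)) * v (y - a) :=
  rfl

theorem errorOp_errorOp (a b a' b' : Fin n → F) (v : StateSpace F n) :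
    errorOp p a b (errorOp p a' b' v) =
      phase p (b ⬝ᵥ a') • errorOp p (a + a') (b + b') v := by
  ext y
  simp only [errorOp_apply, PiLp.smul_apply, smul_eq_mul, ← mul_assoc, ← phase_add, sub_sub]
  congr 2
  simp only [dotProduct_sub, add_dotProduct, dotProduct_add]
  ring

theorem errorOp_zero : errorOp p (0 : Fin n → F) 0 = LinearMap.id := by
  ext v y
  simp [errorOp_apply, phase_zero]

/-- Two error operators commute up to the phase given by the symplectic form of their labels. -/
theorem phase_smul_errorOp_errorOp (a b a' b' : Fin n → F) (v : StateSpace F n) :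
    phase p (b' ⬝ᵥ a) • errorOp p a b (errorOp p a' b' v) =
      phase p (b ⬝ᵥ a') • errorOp p a' b' (errorOp p a b v) := by
  rw [errorOp_errorOp, errorOp_errorOp, smul_smul, smul_smul, add_comm a', add_comm b', mul_comm]

theorem inner_errorOp_errorOp (a b : Fin n → F) (u v : StateSpace F n) :
    inner ℂ (errorOp p a b u) (errorOp p a b v) = inner ℂ u v := by
  rw [PiLp.inner_apply, PiLp.inner_apply,
    ← Equiv.sum_comp (Equiv.subRight a) fun y => inner ℂ (u y) (v y)]
  refine Finset.sum_congr rfl fun y _ => ?_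
  have h : star (phase p (b ⬝ᵥ (y - a))) * phase p (b ⬝ᵥ (y - a)) = 1 := by
    rw [Complex.star_def, Complex.conj_mul', norm_phase]; simp
  simp only [errorOp_apply, Equiv.subRight_apply, RCLike.inner_apply, map_mul]
  rw [Complex.star_def] at h
  linear_combination (v (y - a)) * (starRingEnd ℂ) (u (y - a)) * h

theorem errorOp_ne_zero (a b : Fin n → F) {v : StateSpace F n} (hv : v ≠ 0) :
    errorOp p a b v ≠ 0 := by
  intro h
  have := inner_errorOp_errorOp p a b v v
  rw [h, inner_zero_left] at this
  exact hv (inner_self_eq_zero.1 this.symm)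

theorem sum_phase_dotProduct {b : Fin n → F} (hb : b ≠ 0) :
    ∑ y : Fin n → F, phase p (b ⬝ᵥ y) = 0 := by
  let ψ : AddChar (Fin n → F) ℂ :=
    { toFun := fun y => phase p (b ⬝ᵥ y)
      map_zero_eq_one' := by simp [phase_zero]
      map_add_eq_mul' := fun x y => by rw [dotProduct_add, phase_add] }
  have hψ : ψ ≠ 1 := by
    intro h
    refine hb (funext fun i => eq_zero_of_forall_phase_mul p fun y => ?_)
    have := DFunLike.congr_fun h (Pi.single i y)
    simpa [ψ] using this
  exact AddChar.sum_eq_zero_of_ne_one hψ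

/-- The nontrivial error operators are traceless. -/
theorem trace_errorOp {a b : Fin n → F} (h : a ≠ 0 ∨ b ≠ 0) :
    LinearMap.trace ℂ (StateSpace F n) (errorOp p a b) = 0 := by
  classical
  rw [LinearMap.trace_eq_matrix_trace ℂ (EuclideanSpace.basisFun (Fin n → F) ℂ).toBasis,
    Matrix.trace]
  have key : ∀ y, (LinearMap.toMatrix (EuclideanSpace.basisFun (Fin n → F) ℂ).toBasis
      (EuclideanSpace.basisFun (Fin n → F) ℂ).toBasis (errorOp p a b)).diag y =
      if a = 0 then phase p (b ⬝ᵥ y) else 0 := by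
    intro y
    rw [Matrix.diag_apply, LinearMap.toMatrix_apply]
    simp only [OrthonormalBasis.coe_toBasis, OrthonormalBasis.coe_toBasis_repr_apply,
      EuclideanSpace.basisFun_repr, EuclideanSpace.basisFun_apply, errorOp_apply,
      PiLp.single_apply, sub_eq_self]
    split_ifs with h0 <;> simp [h0]
  simp only [key]
  split_ifs with h0
  · exact sum_phase_dotProduct p (h.resolve_left (not_not.2 h0))
  · simp

end ErrorOperators

/-! ### Stabilizer codes of isotropic groups -/

/-- Finitely many commuting endomorphisms of a nonzero space have a common eigenvector. -/
theorem exists_common_eigenvector {V ι : Type*} [AddCommGroup V] [Module ℂ V]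
    [FiniteDimensional ℂ V] [Nontrivial V] (T : ι → End ℂ V) (s : Finset ι)
    (hT : ∀ i ∈ s, ∀ j ∈ s, Commute (T i) (T j)) :
    ∃ v : V, v ≠ 0 ∧ ∀ i ∈ s, ∃ μ : ℂ, T i v = μ • v := by
  classical
  suffices h : ∃ μ : ι → ℂ, (⨅ i ∈ s, End.eigenspace (T i) (μ i)) ≠ ⊥ by
    obtain ⟨μ, hμ⟩ := h
    obtain ⟨v, hv, hv0⟩ := Submodule.exists_mem_ne_zero_of_ne_bot hμ
    simp only [Submodule.mem_iInf, End.mem_eigenspace_iff] at hv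
    exact ⟨v, hv0, fun i hi => ⟨μ i, hv i hi⟩⟩
  induction s using Finset.induction_on with
  | empty => exact ⟨0, by simp⟩
  | insert j s hj ih =>
    obtain ⟨μ, hμ⟩ := ih fun i hi k hk =>
      hT i (Finset.mem_insert_of_mem hi) k (Finset.mem_insert_of_mem hk)
    set W := ⨅ i ∈ s, End.eigenspace (T i) (μ i) with hW
    have hmaps : ∀ v ∈ W, T j v ∈ W := by
      intro v hv
      simp only [hW, Submodule.mem_iInf, End.mem_eigenspace_iff] at hv ⊢
      intro i hi
      have := hT i (Finset.mem_insert_of_mem hi) j (Finset.mem_insert_self j s)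
      rw [← End.mul_apply, this.eq, End.mul_apply, hv i hi, map_smul]
    have : Nontrivial W := Submodule.nontrivial_iff_ne_bot.2 hμ
    obtain ⟨ν, hν⟩ := End.exists_eigenvalue ((T j).restrict hmaps)
    obtain ⟨w, hw⟩ := hν.exists_hasEigenvector
    refine ⟨Function.update μ j ν, ?_⟩
    rw [Submodule.ne_bot_iff]
    refine ⟨w, ?_, fun h => hw.2 (Subtype.ext h)⟩
    have hw1 := congrArg Subtype.val hw.apply_eq_smul
    have hw2 := w.2
    simp only [hW, Submodule.mem_iInf, End.mem_eigenspace_iff] at hw2 ⊢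
    intro i hi
    by_cases hij : i = j
    · subst hij
      simpa using hw1
    · rw [Function.update_of_ne hij]
      exact hw2 i (Finset.mem_of_mem_insert_of_ne hi hij)

section Stabilizer

variable (p : ℕ) [Fact p.Prime] {F : Type*} [Field F] [Algebra (ZMod p) F] {n : ℕ}

/-- The group `D` of labels `(a, b)` is isotropic for the trace-symplectic form: the error operators
`E(a, b)` with `(a, b) ∈ D` commute with each other. -/
def IsIsotropic (D : AddSubgroup ((Fin n → F) × (Fin n → F))) : Prop :=
  ∀ d ∈ D, ∀ e ∈ D, phase p (d.2 ⬝ᵥ e.1) = phase p (e.2 ⬝ᵥ d.1)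

variable [Fintype F]

/-- Phases `c d` for which `d ↦ c d • E(d)` is multiplicative on `D`. -/
structure IsPhaseLift (D : AddSubgroup ((Fin n → F) × (Fin n → F)))
    (c : (Fin n → F) × (Fin n → F) → ℂ) : Prop where
  norm_eq : ∀ d ∈ D, ‖c d‖ = 1
  map_add : ∀ d ∈ D, ∀ e ∈ D, c (d + e) = c d * c e * phase p (d.2 ⬝ᵥ e.1)
  /-- The operators `c d • E(d)` have a common nonzero fixed vector. -/
  exists_fixed : ∃ v : StateSpace F n, v ≠ 0 ∧ ∀ d ∈ D, c d • errorOp p d.1 d.2 v = v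

variable {p}

/-- An isotropic group lifts to the error group: the inverse eigenvalues at a common eigenvector
of the operators `E(d)` serve as phases. -/
theorem IsIsotropic.exists_isPhaseLift {D : AddSubgroup ((Fin n → F) × (Fin n → F))}
    (hD : IsIsotropic p D) : ∃ c, IsPhaseLift p D c := by
  classical
  obtain ⟨v, hv, h⟩ := exists_common_eigenvector
    (fun d : (Fin n → F) × (Fin n → F) => (errorOp p d.1 d.2 : End ℂ (StateSpace F n)))
    (Finset.univ.filter (· ∈ D)) (by
      intro d hd e he
      simp only [Finset.mem_filter, Finset.mem_univ, true_and] at hd he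
      refine LinearMap.ext fun u => ?_
      have := phase_smul_errorOp_errorOp p d.1 d.2 e.1 e.2 u
      rw [hD d hd e he] at this
      exact smul_right_injective _ (phase_ne_zero p _) this)
  simp only [Finset.mem_filter, Finset.mem_univ, true_and] at h
  choose! μ hμ using h
  have hnorm : ∀ d ∈ D, ‖μ d‖ = 1 := by
    intro d hd
    have h1 := inner_errorOp_errorOp p d.1 d.2 v v
    rw [hμ d hd, inner_self_eq_norm_sq_to_K, inner_self_eq_norm_sq_to_K, norm_smul] at h1
    have h2 : (‖μ d‖ * ‖v‖) ^ 2 = ‖v‖ ^ 2 := by exact_mod_cast h1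
    have h3 : 0 < ‖v‖ := norm_pos_iff.2 hv
    rw [mul_pow] at h2
    have h4 : ‖μ d‖ ^ 2 = 1 := mul_right_cancel₀ (pow_pos h3 2).ne' (by rw [h2, one_mul])
    exact (pow_eq_one_iff_of_nonneg (norm_nonneg _) two_ne_zero).1 h4
  have hne : ∀ d ∈ D, μ d ≠ 0 := fun d hd h0 => by simpa [h0] using hnorm d hd
  refine ⟨fun d => (μ d)⁻¹, fun d hd => by simp [hnorm d hd], fun d hd e he => ?_, v, hv,
    fun d hd => by rw [hμ d hd, inv_smul_smul₀ (hne d hd)]⟩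
  have h1 := errorOp_errorOp p d.1 d.2 e.1 e.2 v
  rw [hμ e he, map_smul, hμ d hd, ← Prod.fst_add, ← Prod.snd_add, hμ _ (D.add_mem hd he), smul_smul,
    smul_smul] at h1
  have h2 := smul_left_injective ℂ hv h1
  have := hne d hd
  have := hne e he
  have := hne _ (D.add_mem hd he)
  field_simp
  rw [mul_comm (μ d), h2, mul_comm]

/-- The joint fixed space of the operators `c d • E(d)`, `d ∈ D`. -/
def fixedSpace (p : ℕ) [Fact p.Prime] [Algebra (ZMod p) F]
    (D : AddSubgroup ((Fin n → F) × (Fin n → F)))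
    (c : (Fin n → F) × (Fin n → F) → ℂ) : Submodule ℂ (StateSpace F n) where
  carrier := {v | ∀ d ∈ D, c d • errorOp p d.1 d.2 v = v}
  zero_mem' := by simp
  add_mem' := by
    intro u v hu hv d hd
    rw [map_add, smul_add, hu d hd, hv d hd]
  smul_mem' := by
    intro r v hv d hd
    rw [map_smul, smul_comm, hv d hd]

open Classical in
/-- The average of the operators `c d • E(d)`, `d ∈ D`. -/
noncomputable def fixedProj (p : ℕ) [Fact p.Prime] [Algebra (ZMod p) F]
    (D : AddSubgroup ((Fin n → F) × (Fin n → F)))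
    (c : (Fin n → F) × (Fin n → F) → ℂ) : StateSpace F n →ₗ[ℂ] StateSpace F n :=
  (Nat.card D : ℂ)⁻¹ • ∑ d : D, c d • errorOp p d.1.1 d.1.2

variable {D : AddSubgroup ((Fin n → F) × (Fin n → F))} {c : (Fin n → F) × (Fin n → F) → ℂ}

theorem IsPhaseLift.map_zero (hc : IsPhaseLift p D c) : c 0 = 1 := by
  have h := hc.map_add 0 D.zero_mem 0 D.zero_mem
  have h0 : c 0 ≠ 0 := fun h0 => by simpa [h0] using hc.norm_eq 0 D.zero_mem
  rw [add_zero, Prod.snd_zero, zero_dotProduct, phase_zero, mul_one] at h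
  exact mul_left_cancel₀ h0 (by rw [← h, mul_one])

theorem IsPhaseLift.fixedSpace_ne_bot (hc : IsPhaseLift p D c) : fixedSpace p D c ≠ ⊥ := by
  obtain ⟨v, hv, h⟩ := hc.exists_fixed
  exact (Submodule.ne_bot_iff _).2 ⟨v, h, hv⟩

theorem IsPhaseLift.smul_mem_stabilizer (hc : IsPhaseLift p D c) {d : (Fin n → F) × (Fin n → F)}
    (hd : d ∈ D) : c d • errorOp p d.1 d.2 ∈ stabilizer p (fixedSpace p D c) :=
  ⟨⟨c d, d.1, d.2, hc.norm_eq d hd, rfl⟩, fun _ hv => hv d hd⟩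

theorem IsPhaseLift.isStabilizerCode (hc : IsPhaseLift p D c) :
    IsStabilizerCode p (fixedSpace p D c) :=
  ⟨hc.fixedSpace_ne_bot, fun _ => ⟨fun hv _ hT => hT.2 _ hv,
    fun h _ hd => h _ (hc.smul_mem_stabilizer hd)⟩⟩

/-- Averaging over the lifted group is the projection onto its joint fixed space. -/
theorem IsPhaseLift.isProj (hc : IsPhaseLift p D c) :
    LinearMap.IsProj (fixedSpace p D c) (fixedProj p D c) := by
  classical
  constructor
  · intro v e he
    rw [fixedProj, LinearMap.smul_apply, LinearMap.sum_apply, map_smul, smul_comm, map_sum,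
      Finset.smul_sum]
    congr 1
    conv_rhs => rw [← Equiv.sum_comp (Equiv.addLeft (⟨e, he⟩ : D))]
    refine Finset.sum_congr rfl fun d _ => ?_
    rw [Equiv.coe_addLeft, AddSubgroup.coe_add, hc.map_add e he d d.2, LinearMap.smul_apply,
      LinearMap.smul_apply, map_smul, errorOp_errorOp, smul_smul, smul_smul, Prod.fst_add,
      Prod.snd_add, mul_assoc (c e)]
  · intro v hv
    rw [fixedProj, LinearMap.smul_apply, LinearMap.sum_apply,
      Finset.sum_congr rfl fun d _ => (LinearMap.smul_apply _ _ v).trans (hv d.1 d.2),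
      Finset.sum_const, Finset.card_univ, ← Nat.card_eq_fintype_card, ← Nat.cast_smul_eq_nsmul ℂ,
      inv_smul_smul₀]
    exact_mod_cast (Nat.card_pos (α := D)).ne'

/-- Only the trivial element contributes to the trace of the projection. -/
theorem IsPhaseLift.finrank_mul_card (hc : IsPhaseLift p D c) :
    finrank ℂ (fixedSpace p D c) * Nat.card D = Fintype.card F ^ n := by
  classical
  have h := hc.isProj.trace
  rw [fixedProj, map_smul, map_sum, Finset.sum_eq_single (0 : D)] at h
  · rw [AddSubgroup.coe_zero, hc.map_zero, one_smul, Prod.fst_zero, Prod.snd_zero, errorOp_zero,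
      LinearMap.trace_id, finrank_euclideanSpace, Fintype.card_fun, Fintype.card_fin] at h
    have h0 : (Nat.card D : ℂ) ≠ 0 := by exact_mod_cast (Nat.card_pos (α := D)).ne'
    rw [smul_eq_mul, inv_mul_eq_iff_eq_mul₀ h0] at h
    rw [mul_comm]
    exact_mod_cast h.symm
  · intro d _ hd
    rw [map_smul, trace_errorOp, smul_zero]
    by_contra! h
    exact hd (Subtype.ext (Prod.ext h.1 h.2))
  · simp

/-- An error operator that acts on the code as a scalar has its label in `D`: for all other labels,
the product of the operator with the projection onto the code is traceless. -/
theorem IsPhaseLift.mem_of_forall_eq_smul (hc : IsPhaseLift p D c) {a b : Fin n → F} {r : ℂ}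
    (h : ∀ v ∈ fixedSpace p D c, errorOp p a b v = r • v) : (a, b) ∈ D := by
  classical
  by_contra hab
  have hP : errorOp p a b ∘ₗ fixedProj p D c = r • fixedProj p D c :=
    LinearMap.ext fun v => h _ (hc.isProj.map_mem v)
  have htr := congrArg (LinearMap.trace ℂ (StateSpace F n)) hP
  have h0 : LinearMap.trace ℂ (StateSpace F n) (errorOp p a b ∘ₗ fixedProj p D c) = 0 := by
    have hsum : errorOp p a b ∘ₗ fixedProj p D c =
        (Nat.card D : ℂ)⁻¹ • ∑ d : D, errorOp p a b ∘ₗ (c d • errorOp p d.1.1 d.1.2) :=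
      LinearMap.ext fun v => by simp [fixedProj]
    rw [hsum, map_smul, map_sum, Finset.sum_eq_zero, smul_zero]
    intro d _
    have : errorOp p a b ∘ₗ (c d • errorOp p d.1.1 d.1.2) =
        (c d * phase p (b ⬝ᵥ d.1.1)) • errorOp p (a + d.1.1) (b + d.1.2) :=
      LinearMap.ext fun v => by
        rw [LinearMap.comp_apply, LinearMap.smul_apply, map_smul, errorOp_errorOp, smul_smul,
          LinearMap.smul_apply]
    rw [this, map_smul, trace_errorOp, smul_zero]
    by_contra! hd
    refine hab ?_
    have : (a, b) = -d.1 := Prod.ext (eq_neg_of_add_eq_zero_left hd.1)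
      (eq_neg_of_add_eq_zero_left hd.2)
    rw [this]
    exact D.neg_mem d.2
  obtain ⟨v, hv, hv0⟩ := Submodule.exists_mem_ne_zero_of_ne_bot hc.fixedSpace_ne_bot
  rw [h0, map_smul, hc.isProj.trace, smul_eq_mul, eq_comm, mul_eq_zero] at htr
  rcases htr with hr | hr
  · exact errorOp_ne_zero p a b hv0 (by rw [h v hv, hr, zero_smul])
  · have h1 := hc.finrank_mul_card
    rw [Nat.cast_eq_zero.1 hr, zero_mul] at h1
    exact (pow_pos Fintype.card_pos n).ne h1

theorem IsPhaseLift.exists_smul_mem_stabilizer_iff (hc : IsPhaseLift p D c) {a b : Fin n → F} :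
    (∃ r : ℂ, r • errorOp p a b ∈ stabilizer p (fixedSpace p D c)) ↔ (a, b) ∈ D := by
  refine ⟨fun ⟨r, hr⟩ => ?_, fun h => ⟨c (a, b), hc.smul_mem_stabilizer h⟩⟩
  obtain ⟨v, hv, hv0⟩ := Submodule.exists_mem_ne_zero_of_ne_bot hc.fixedSpace_ne_bot
  have hr0 : r ≠ 0 := by
    rintro rfl
    exact hv0 (by simpa using (hr.2 v hv).symm)
  refine hc.mem_of_forall_eq_smul (r := r⁻¹) fun u hu => ?_
  rw [eq_inv_smul_iff₀ hr0]
  exact hr.2 u hu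

/-- The label `(a, b)` is orthogonal to `D` for the trace-symplectic form: `E(a, b)` commutes with
all `E(d)`, `d ∈ D`. -/
def IsOrthogonalTo (p : ℕ) [Fact p.Prime] [Algebra (ZMod p) F]
    (D : AddSubgroup ((Fin n → F) × (Fin n → F))) (a b : Fin n → F) : Prop :=
  ∀ d ∈ D, phase p (d.2 ⬝ᵥ a) = phase p (b ⬝ᵥ d.1)

/-- An error that fails to commute with the stabilizer maps the code to an orthogonal space. -/
theorem IsPhaseLift.inner_eq_zero (hc : IsPhaseLift p D c) {a b : Fin n → F}
    (h : ¬ IsOrthogonalTo p D a b) {u v : StateSpace F n} (hu : u ∈ fixedSpace p D c)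
    (hv : v ∈ fixedSpace p D c) : inner ℂ u (errorOp p a b v) = 0 := by
  simp only [IsOrthogonalTo, not_forall] at h
  obtain ⟨d, hd, hne⟩ := h
  have h1 : phase p (b ⬝ᵥ d.1) • (c d • errorOp p d.1 d.2 (errorOp p a b v)) =
      phase p (d.2 ⬝ᵥ a) • errorOp p a b v := by
    rw [smul_comm, phase_smul_errorOp_errorOp, smul_comm, ← map_smul, hv d hd]
  have hstar : starRingEnd ℂ (c d) * c d = 1 := by
    rw [Complex.conj_mul', hc.norm_eq d hd]; simp
  have h2 : inner ℂ u (c d • errorOp p d.1 d.2 (errorOp p a b v)) =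
      inner ℂ u (errorOp p a b v) := by
    conv_lhs => rw [← hu d hd]
    rw [inner_smul_left, inner_smul_right, inner_errorOp_errorOp, ← mul_assoc, hstar, one_mul]
  have h3 := congrArg (inner ℂ u) h1
  rw [inner_smul_right _ (c d • _), h2, inner_smul_right, ← sub_eq_zero, ← sub_mul,
    mul_eq_zero] at h3
  exact h3.resolve_left (sub_ne_zero.2 (Ne.symm hne))

/-- An error that commutes with the stabilizer maps the code to itself. -/
theorem errorOp_mem_fixedSpace {a b : Fin n → F}
    (h : IsOrthogonalTo p D a b) {v : StateSpace F n} (hv : v ∈ fixedSpace p D c) :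
    errorOp p a b v ∈ fixedSpace p D c := by
  intro d hd
  have h1 := phase_smul_errorOp_errorOp p d.1 d.2 a b v
  rw [h d hd] at h1
  rw [smul_right_injective _ (phase_ne_zero p _) h1, ← map_smul, hv d hd]

/-- The undetectable errors are those whose labels are orthogonal to `D` without belonging to
it. -/
theorem IsPhaseLift.detectsBelow_iff [DecidableEq F] (hc : IsPhaseLift p D c) (e : ℕ) :
    DetectsBelow p (fixedSpace p D c) e ↔
      ∀ a b : Fin n → F, IsOrthogonalTo p D a b → (a, b) ∉ D → e ≤ errorWeight a b := by
  constructor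
  · intro h a b hab hD
    by_contra! hlt
    obtain ⟨r, hr⟩ := h a b hlt
    refine hD (hc.mem_of_forall_eq_smul (r := r) fun v hv => ?_)
    have hmem : errorOp p a b v - r • v ∈ fixedSpace p D c :=
      Submodule.sub_mem _ (errorOp_mem_fixedSpace hab hv) (Submodule.smul_mem _ _ hv)
    rw [← sub_eq_zero, ← inner_self_eq_zero (𝕜 := ℂ)]
    rw [inner_sub_right, inner_smul_right, hr _ hmem v hv, sub_self]
  · intro h a b hlt
    by_cases hab : IsOrthogonalTo p D a b
    · by_cases hD : (a, b) ∈ D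
      · have hc0 : c (a, b) ≠ 0 := fun h0 => by simpa [h0] using hc.norm_eq _ hD
        refine ⟨(c (a, b))⁻¹, fun u _ v hv => ?_⟩
        rw [← inner_smul_right, ← (eq_inv_smul_iff₀ hc0).2 (hv _ hD)]
      · exact absurd hlt (h a b hab hD).not_gt
    · exact ⟨0, fun u hu v hv => by rw [hc.inner_eq_zero hab hu hv, zero_mul]⟩

end Stabilizer

/-! ### Arithmetic of cyclotomic cosets -/

theorem one_lt_of_le_pow_sub_one {q m δ : ℕ} (hδ : 2 ≤ δ) (hδ' : δ ≤ q ^ m - 1) : 1 < q := by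
  by_contra! h
  have := pow_le_one₀ (Nat.zero_le q) h (n := m)
  omega

theorem pow_mul_modEq_one (q m k : ℕ) (hq : 1 < q) :
    q ^ (2 * m * k) ≡ 1 [MOD q ^ (2 * m) - 1] := by
  have h : 1 ≤ q ^ (2 * m) := Nat.one_le_pow _ _ hq.le
  have := ((Nat.modEq_iff_dvd' h).2 dvd_rfl).symm.pow k
  rwa [one_pow, ← pow_mul] at this

/-- `s + x q^j` is not divisible by `q^(2m) - 1` if `x ≤ q^m - 2`, `s < δ_max` and `j` is odd:
either this number or `x + s q^(2m-j)`, its product with a power of `q`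
up to congruence, is positive and too small. -/
theorem not_dvd_add_mul_pow {q m s x j : ℕ} (hq : 1 < q) (hx : 1 ≤ x) (hx' : x + 2 ≤ q ^ m)
    (hs : (s : ℤ) < deltaMax q m) (hj : Odd j) : ¬ q ^ (2 * m) - 1 ∣ s + x * q ^ j := by
  have hm : 1 ≤ m := by
    rcases Nat.eq_zero_or_pos m with rfl | h
    · simp at hx'
    · exact h
  intro hdvd
  set n := q ^ (2 * m) - 1 with hn
  have h1 : 1 ≤ q ^ (2 * m) := Nat.one_le_pow _ _ hq.le
  -- only the residue of the exponent modulo `2 * m` matters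
  obtain ⟨i, hi, hio, hdvd⟩ : ∃ i < 2 * m, Odd i ∧ n ∣ s + x * q ^ i := by
    refine ⟨j % (2 * m), Nat.mod_lt _ (by omega), ?_, ?_⟩
    · rw [Nat.odd_iff, Nat.mod_mul_right_mod]
      exact Nat.odd_iff.1 hj
    · refine (Nat.ModEq.dvd_iff (Nat.ModEq.add_left s (Nat.ModEq.mul_left x ?_)) dvd_rfl).1 hdvd
      conv_lhs => rw [← Nat.mod_add_div j (2 * m), pow_add]
      simpa using (pow_mul_modEq_one q m (j / (2 * m)) hq).mul_left (q ^ (j % (2 * m)))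
  have hdvd' : n ∣ s * q ^ (2 * m - i) + x := by
    have h := hdvd.mul_right (q ^ (2 * m - i))
    rw [add_mul, mul_assoc, ← pow_add, Nat.add_sub_cancel' hi.le] at h
    refine (Nat.ModEq.dvd_iff (Nat.ModEq.add_left _ ?_) dvd_rfl).1 h
    simpa using (pow_mul_modEq_one q m 1 hq).mul_left x
  have hle : q ^ (2 * m) - 1 ≤ s + x * q ^ i :=
    Nat.le_of_dvd (Nat.add_pos_right _ (Nat.mul_pos hx (pow_pos (by omega) _))) hdvd
  have hle' : q ^ (2 * m) - 1 ≤ s * q ^ (2 * m - i) + x :=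
    Nat.le_of_dvd (Nat.add_pos_right _ hx) hdvd'
  have hsq : q ^ (2 * m) = q ^ m * q ^ m := by rw [two_mul, pow_add]
  have hpos : 1 ≤ q ^ m := Nat.one_le_pow _ _ hq.le
  rcases Nat.even_or_odd m with he | ho
  · have hs' : s + q ^ 2 ≤ q ^ (m + 1) := by
      simp only [deltaMax, he, if_true] at hs
      zify
      linarith
    have hq2 : 4 ≤ q ^ 2 := by nlinarith
    have hm2 : 2 ≤ m := by
      obtain ⟨r, hr⟩ := he
      omega
    rcases lt_or_ge i m with him | him
    · have h2 : q ^ i ≤ q ^ (m - 1) := Nat.pow_le_pow_right hq.le (by omega)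
      have h3 : q ^ (m + 1) ≤ q ^ m * q ^ (m - 1) := by
        rw [← pow_add]
        exact Nat.pow_le_pow_right hq.le (by omega)
      have h4 : q ^ m = q ^ (m - 1) * q := by rw [← pow_succ, Nat.sub_add_cancel hm]
      have h5 : x * q ^ i ≤ (q ^ m - 2) * q ^ (m - 1) := Nat.mul_le_mul (by omega) h2
      have h6 : (q ^ m - 2) * q ^ (m - 1) ≤ q ^ m * q ^ (m - 1) :=
        Nat.mul_le_mul_right _ (Nat.sub_le _ _)
      have h7 : 2 * (q ^ m * q ^ (m - 1)) ≤ q ^ m * q ^ m := by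
        conv_rhs => rw [h4]
        rw [← h4]
        nlinarith [Nat.zero_le (q ^ m * q ^ (m - 1))]
      omega
    -- an odd exponent differs from the even number `m`
    · have him' : m + 1 ≤ i := by
        rcases him.lt_or_eq with h | h
        · exact h
        · rw [← h] at hio
          exact absurd he (Nat.not_even_iff_odd.2 hio)
      have h2 : q ^ (2 * m - i) ≤ q ^ (m - 1) := Nat.pow_le_pow_right hq.le (by omega)
      have h3 : s * q ^ (2 * m - i) ≤ (q ^ (m + 1) - q ^ 2) * q ^ (m - 1) :=
        Nat.mul_le_mul (by omega) h2
      have h4 : (q ^ (m + 1) - q ^ 2) * q ^ (m - 1) + q * q ^ m = q ^ m * q ^ m := by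
        have h5 : q ^ 2 ≤ q ^ (m + 1) := Nat.pow_le_pow_right hq.le (by omega)
        zify [h5]
        rw [sub_mul, ← pow_add, ← pow_add, ← pow_add, ← pow_succ']
        rw [show m + 1 + (m - 1) = m + m by omega, show 2 + (m - 1) = m + 1 by omega]
        ring
      have h5 : 2 * q ^ m ≤ q * q ^ m := Nat.mul_le_mul_right _ hq
      omega
  · have hs' : s + 2 ≤ q ^ m := by
      simp only [deltaMax, Nat.not_even_iff_odd.2 ho, if_false] at hs
      zify
      simp only [add_zero, mul_zero, sub_zero] at hs
      linarith
    rcases le_total i m with him | him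
    · have h2 : q ^ i ≤ q ^ m := Nat.pow_le_pow_right hq.le him
      have h3 : x * q ^ i ≤ (q ^ m - 2) * q ^ m := Nat.mul_le_mul (by omega) h2
      have h4 : (q ^ m - 2) * q ^ m + 2 * q ^ m = q ^ m * q ^ m := by
        rw [← add_mul, Nat.sub_add_cancel (by omega)]
      omega
    · have h2 : q ^ (2 * m - i) ≤ q ^ m := Nat.pow_le_pow_right hq.le (by omega)
      have h3 : s * q ^ (2 * m - i) ≤ (q ^ m - 2) * q ^ m := Nat.mul_le_mul (by omega) h2
      have h4 : (q ^ m - 2) * q ^ m + 2 * q ^ m = q ^ m * q ^ m := by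
        rw [← add_mul, Nat.sub_add_cancel (by omega)]
      omega

/-- The cyclotomic cosets of the numbers `0 < x < q^m - 1` with `q^2 ∤ x` are distinct and have `m`
elements: an element `x q^(2j)` of one of them is congruent to such a number only if `j = 0`. -/
theorem eq_zero_of_modEq_mul_pow {q m x y j : ℕ} (hq : 1 < q) (hx : x + 2 ≤ q ^ m)
    (hy : y + 2 ≤ q ^ m) (hqx : ¬ q ^ 2 ∣ x) (hqy : ¬ q ^ 2 ∣ y) (hj : j < m)
    (h : y ≡ x * (q ^ 2) ^ j [MOD q ^ (2 * m) - 1]) : j = 0 := by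
  -- no reduction takes place if the exponent of `q` is at most `m`
  have key : ∀ {x y j : ℕ}, x + 2 ≤ q ^ m → y + 2 ≤ q ^ m → ¬ q ^ 2 ∣ y → 2 * j ≤ m →
      y ≡ x * (q ^ 2) ^ j [MOD q ^ (2 * m) - 1] → j = 0 := by
    intro x y j hx hy hqy hj h
    have hsq : q ^ (2 * m) = q ^ m * q ^ m := by rw [two_mul, pow_add]
    have h2 : (q ^ 2) ^ j ≤ q ^ m := by
      rw [← pow_mul]
      exact Nat.pow_le_pow_right hq.le hj
    have h3 : x * (q ^ 2) ^ j ≤ (q ^ m - 2) * q ^ m := Nat.mul_le_mul (by omega) h2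
    have h4 : (q ^ m - 2) * q ^ m + 2 * q ^ m = q ^ m * q ^ m := by
      rw [← add_mul, Nat.sub_add_cancel (by omega)]
    have h5 : 2 * q ^ m ≤ q ^ m * q ^ m := Nat.mul_le_mul_right _ (by omega)
    have h6 : y = x * (q ^ 2) ^ j := Nat.ModEq.eq_of_lt_of_lt h (by omega) (by omega)
    by_contra hj0
    exact hqy (h6 ▸ (dvd_pow_self _ hj0).mul_left x)
  rcases le_or_gt (2 * j) m with h2 | h2
  · exact key hx hy hqy h2 h
  · have h3 : y * (q ^ 2) ^ (m - j) ≡ x [MOD q ^ (2 * m) - 1] := by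
      refine (h.mul_right _).trans ?_
      rw [mul_assoc, ← pow_add, Nat.add_sub_cancel' hj.le, ← pow_mul]
      simpa using (pow_mul_modEq_one q m 1 hq).mul_left x
    have := key hy hx hqx (by omega) h3.symm
    omega

/-- The numbers `0 < x < δ` that are not divisible by `Q`. They represent the cyclotomic cosets that
make up the defining set. -/
def cosetReps (Q δ : ℕ) : Finset ℕ :=
  (Finset.Icc 1 (δ - 1)).filter fun x => ¬ Q ∣ x

theorem mem_cosetReps {Q δ x : ℕ} : x ∈ cosetReps Q δ ↔ (1 ≤ x ∧ x < δ) ∧ ¬ Q ∣ x := by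
  simp only [cosetReps, Finset.mem_filter, Finset.mem_Icc]
  refine and_congr_left fun _ => ?_
  omega

theorem card_cosetReps (Q δ : ℕ) (hδ : 1 ≤ δ) :
    ((cosetReps Q δ).card : ℤ) = ⌈((δ : ℚ) - 1) * (1 - 1 / (Q : ℚ))⌉ := by
  have h1 := Nat.Ioc_filter_dvd_card_eq_div (δ - 1) Q
  have h2 := Finset.card_filter_add_card_filter_not (s := Finset.Ioc 0 (δ - 1)) (fun x => Q ∣ x)
  have h3 : cosetReps Q δ = (Finset.Ioc 0 (δ - 1)).filter fun x => ¬ Q ∣ x := rfl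
  rw [← h3, h1, Nat.card_Ioc, Nat.sub_zero] at h2
  have h4 : ((δ : ℚ) - 1) * (1 - 1 / (Q : ℚ)) =
      ((δ - 1 : ℕ) : ℤ) - ((δ - 1 : ℕ) : ℚ) / (Q : ℚ) := by
    push_cast [hδ]
    ring
  rw [h4, sub_eq_add_neg, Int.ceil_intCast_add, Int.ceil_neg, Rat.floor_natCast_div_natCast]
  omega

/-! ### Syndromes and the BCH bound -/

section Syndrome

variable {K L : Type*} [Field K] [Field L] [Algebra K L] {n Q m δ : ℕ} {α : L}

/-- The value `∑ c_i γ^i` at `γ` of the polynomial of the word `c`. -/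
def syndrome (K : Type*) {L : Type*} [Field K] [Field L] [Algebra K L] (n : ℕ) (γ : L) :
    (Fin n → K) →ₗ[K] L where
  toFun c := ∑ i, c i • γ ^ (i : ℕ)
  map_add' a b := by simp [add_smul, Finset.sum_add_distrib]
  map_smul' r a := by simp [mul_smul, Finset.smul_sum]

theorem syndrome_apply (γ : L) (c : Fin n → K) :
    syndrome K n γ c = ∑ i, c i • γ ^ (i : ℕ) :=
  rfl

theorem eval_wordPoly (γ : L) (c : Fin n → K) : (wordPoly L c).eval γ = syndrome K n γ c := by
  simp [wordPoly, syndrome_apply, Polynomial.eval_finsetSum, Algebra.smul_def]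

/-- Words over `K` have conjugate values at conjugate points. -/
theorem syndrome_pow_card [Fintype K] (γ : L) (c : Fin n → K) (k : ℕ) :
    syndrome K n (γ ^ Fintype.card K ^ k) c = syndrome K n γ c ^ Fintype.card K ^ k := by
  induction k with
  | zero => simp
  | succ k ih =>
    rw [pow_succ, pow_mul, pow_mul, ← ih]
    generalize γ ^ Fintype.card K ^ k = ε
    change _ = FiniteField.frobeniusAlgHom K L (syndrome K n ε c)
    rw [syndrome_apply, syndrome_apply, map_sum]
    refine Finset.sum_congr rfl fun i _ => ?_
    rw [map_smul, FiniteField.frobeniusAlgHom_apply, ← pow_mul, ← pow_mul, mul_comm]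

theorem mem_bchCode_iff_forall_definingSet (hα : IsPrimitiveRoot α n) (hn : 0 < n)
    (c : Fin n → K) :
    c ∈ bchCode K n Q m δ α ↔ ∀ z ∈ definingSet n Q m δ, syndrome K n (α ^ z) c = 0 := by
  change generatorPoly n Q m δ α ∣ wordPoly L c ↔ _
  simp_rw [← eval_wordPoly]
  constructor
  · intro h z hz
    have hz' := Finset.dvd_prod_of_mem
      (fun z => (Polynomial.X - Polynomial.C (α ^ z) : Polynomial L)) hz
    exact Polynomial.dvd_iff_isRoot.1 (hz'.trans h)
  · intro h
    refine Finset.prod_dvd_of_coprime ?_ fun z hz => Polynomial.dvd_iff_isRoot.2 (h z hz)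
    intro y hy z hz hyz
    change IsCoprime (Polynomial.X - Polynomial.C (α ^ y)) (Polynomial.X - Polynomial.C (α ^ z))
    refine Polynomial.isCoprime_X_sub_C_of_isUnit_sub (sub_ne_zero.2 fun h => hyz ?_).isUnit
    have hlt : ∀ z ∈ definingSet n Q m δ, z < n := by
      intro z hz
      simp only [definingSet, cyclotomicCoset, Finset.mem_biUnion, Finset.mem_image] at hz
      obtain ⟨x, -, k, -, rfl⟩ := hz
      exact Nat.mod_lt _ hn
    exact hα.pow_inj (hlt y hy) (hlt z hz) h

/-- The BCH code consists of the words that vanish at `α, …, α^(δ-1)`; the conjugates of these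
points are taken care of by the Frobenius automorphism. -/
theorem mem_bchCode_iff [Fintype K] (hα : IsPrimitiveRoot α n) (hn : 0 < n) (hm : 1 ≤ m)
    (hQ : Fintype.card K = Q) (c : Fin n → K) :
    c ∈ bchCode K n Q m δ α ↔ ∀ x, 1 ≤ x → x < δ → syndrome K n (α ^ x) c = 0 := by
  have hmod : ∀ z, α ^ (z % n) = α ^ z := fun z => by
    rw [hα.eq_orderOf, pow_mod_orderOf]
  rw [mem_bchCode_iff_forall_definingSet hα hn]
  simp only [definingSet, cyclotomicCoset, Finset.mem_biUnion, Finset.mem_image, Finset.mem_Icc,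
    Finset.mem_range]
  constructor
  · intro h x hx hx'
    rw [← hmod]
    exact h _ ⟨x, ⟨hx, by omega⟩, 0, hm, by simp⟩
  · rintro h z ⟨x, ⟨hx, hx'⟩, k, -, rfl⟩
    rw [hmod, pow_mul, ← hQ, syndrome_pow_card, h x hx (by omega),
      zero_pow (pow_pos Fintype.card_pos k).ne']

/-- It suffices to test one exponent from each cyclotomic coset. -/
theorem mem_bchCode_iff_forall_cosetReps [Fintype K] (hα : IsPrimitiveRoot α n) (hn : 0 < n)
    (hm : 1 ≤ m) (hQ : Fintype.card K = Q) (c : Fin n → K) :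
    c ∈ bchCode K n Q m δ α ↔ ∀ x ∈ cosetReps Q δ, syndrome K n (α ^ x) c = 0 := by
  rw [mem_bchCode_iff hα hn hm hQ]
  refine ⟨fun h x hx => h x (mem_cosetReps.1 hx).1.1 (mem_cosetReps.1 hx).1.2,
    fun h x hx hx' => ?_⟩
  have hQ1 : 1 < Q := hQ ▸ Fintype.one_lt_card
  obtain ⟨k, y, hy, rfl⟩ := Nat.exists_eq_pow_mul_and_not_dvd (n := x) (by omega) Q hQ1.ne'
  have hy0 : 1 ≤ y := Nat.pos_of_ne_zero (by rintro rfl; simp at hx)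
  have hyδ : y < δ := lt_of_le_of_lt (Nat.le_mul_of_pos_left y (pow_pos (by omega) k)) hx'
  rw [mul_comm, pow_mul, ← hQ, syndrome_pow_card, h y (mem_cosetReps.2 ⟨⟨hy0, hyδ⟩, hy⟩),
    zero_pow (pow_pos Fintype.card_pos k).ne']

/-- The BCH bound: a nonzero word that vanishes at `t` consecutive powers of `α` has weight greater
than `t`. The polynomial with roots `α^j`, where `j ≠ i` runs through the support, isolates the
`i`-th coordinate. -/
theorem lt_hammingNorm_of_syndrome_eq_zero [DecidableEq K] (hα : IsPrimitiveRoot α n)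
    {c : Fin n → K} (hc : c ≠ 0) (b t : ℕ) (h : ∀ s < t, syndrome K n (α ^ (b + s)) c = 0) :
    t < hammingNorm c := by
  obtain ⟨i, hi⟩ := Function.ne_iff.1 hc
  by_contra! hle
  set S := (Finset.univ.filter fun j => c j ≠ 0).erase i with hS
  have hn : n ≠ 0 := fun h0 => (Fin.cast h0 i).elim0
  have hα0 : α ≠ 0 := hα.ne_zero hn
  have hiS : i ∈ Finset.univ.filter fun j => c j ≠ 0 := by simpa using hi
  have hcard : S.card < t := by
    have : S.card + 1 = hammingNorm c := Finset.card_erase_add_one hiS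
    omega
  set f : Polynomial L := ∏ j ∈ S, (Polynomial.X - Polynomial.C (α ^ (j : ℕ))) with hf
  have hdeg : f.natDegree < t := by
    rw [hf, Polynomial.natDegree_prod_of_monic _ _ fun j _ => Polynomial.monic_X_sub_C _]
    simp only [Polynomial.natDegree_X_sub_C]
    simpa using hcard
  have hsum : ∑ j, c j • (α ^ (j * b : ℕ) * f.eval (α ^ (j : ℕ))) = 0 := by
    have : ∀ j : Fin n, c j • (α ^ (j * b : ℕ) * f.eval (α ^ (j : ℕ))) =
        ∑ s ∈ Finset.range t, f.coeff s * (c j • (α ^ (b + s)) ^ (j : ℕ)) := by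
      intro j
      rw [Polynomial.eval_eq_sum_range' hdeg, Finset.mul_sum, Finset.smul_sum]
      refine Finset.sum_congr rfl fun s _ => ?_
      rw [mul_smul_comm, ← pow_mul, ← pow_mul, mul_left_comm, ← pow_add]
      congr 3
      ring
    simp_rw [this]
    rw [Finset.sum_comm]
    refine Finset.sum_eq_zero fun s hs => ?_
    rw [← Finset.mul_sum, ← syndrome_apply, h s (Finset.mem_range.1 hs), mul_zero]
  rw [Finset.sum_eq_single i] at hsum
  · rcases smul_eq_zero.1 hsum with h0 | h0
    · exact hi h0
    · rcases mul_eq_zero.1 h0 with h0 | h0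
      · exact pow_ne_zero _ hα0 h0
      · rw [hf, Polynomial.eval_prod, Finset.prod_eq_zero_iff] at h0
        obtain ⟨j, hj, hj0⟩ := h0
        rw [Polynomial.eval_sub, Polynomial.eval_X, Polynomial.eval_C, sub_eq_zero] at hj0
        exact (Finset.mem_erase.1 hj).1 (Fin.ext (hα.pow_inj i.2 j.2 hj0)).symm
  · intro j _ hji
    by_cases hj : c j = 0
    · rw [hj, zero_smul]
    · have hjS : j ∈ S := Finset.mem_erase.2 ⟨hji, by simpa using hj⟩
      rw [hf, Polynomial.eval_prod, Finset.prod_eq_zero hjS (by simp), mul_zero, smul_zero]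
  · simp

/-! ### Trace words -/

/-- The word with entries `Tr(κ ε^i)`. -/
noncomputable def traceWord (K : Type*) {L : Type*} [Field K] [Field L] [Algebra K L] (n : ℕ)
    (κ ε : L) :
    Fin n → K :=
  fun i => Algebra.trace K L (κ * ε ^ (i : ℕ))

theorem sum_pow_eq_ite {ζ : L} (hζ : ζ ^ n = 1) [Decidable (ζ = 1)] :
    ∑ i : Fin n, ζ ^ (i : ℕ) = if ζ = 1 then (n : L) else 0 := by
  rw [Fin.sum_univ_eq_sum_range (fun i => ζ ^ i) n]
  split_ifs with h
  · simp [h]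
  · have := geom_sum_mul ζ n
    rw [hζ, sub_self] at this
    exact (mul_eq_zero.1 this).resolve_right (sub_ne_zero.2 h)

/-- The value of a trace word at an `n`-th root of unity `γ`. -/
theorem syndrome_traceWord [Fintype K] [Finite L] [DecidableEq L] {γ ε : L} (hγ : γ ^ n = 1)
    (hε : ε ^ n = 1) (κ : L) :
    syndrome K n γ (traceWord K n κ ε) = ∑ k ∈ Finset.range (finrank K L),
      if ε ^ Fintype.card K ^ k * γ = 1 then n * κ ^ Fintype.card K ^ k else 0 := by
  simp only [syndrome_apply, traceWord, Algebra.smul_def, FiniteField.algebraMap_trace_eq_sum_pow,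
    Finset.sum_mul, Nat.card_eq_fintype_card]
  rw [Finset.sum_comm]
  refine Finset.sum_congr rfl fun k _ => ?_
  have h : (ε ^ Fintype.card K ^ k * γ) ^ n = 1 := by
    rw [mul_pow, hγ, mul_one, ← pow_mul, mul_comm, pow_mul, hε, one_pow]
  have hterm : ∀ i : Fin n, (κ * ε ^ (i : ℕ)) ^ Fintype.card K ^ k * γ ^ (i : ℕ) =
      κ ^ Fintype.card K ^ k * (ε ^ Fintype.card K ^ k * γ) ^ (i : ℕ) := by
    intro i
    rw [mul_pow, mul_pow, ← pow_mul, ← pow_mul, mul_comm (i : ℕ), mul_assoc]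
  rw [Finset.sum_congr rfl fun i _ => hterm i, ← Finset.mul_sum, sum_pow_eq_ite h]
  split_ifs
  · rw [mul_comm]
  · rw [mul_zero]

theorem modEq_of_pow_eq_pow (hα : IsPrimitiveRoot α n) (hn : 0 < n) {a b : ℕ}
    (h : α ^ a = α ^ b) : a ≡ b [MOD n] := by
  refine hα.pow_inj (Nat.mod_lt a hn) (Nat.mod_lt b hn) ?_
  rwa [hα.eq_orderOf, pow_mod_orderOf, pow_mod_orderOf]

/-- The syndromes at `α^x`, with `x` from distinct cosets of full size, can be prescribed
arbitrarily: the inverse Fourier transform, which is a sum of trace words, provides a word. -/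
theorem exists_syndrome_eq [Fintype K] [Finite L] (hα : IsPrimitiveRoot α n)
    (hn : (n : L) ≠ 0) (X : Finset ℕ) (hX : ∀ x ∈ X, x < n)
    (hinj : ∀ x ∈ X, ∀ y ∈ X, ∀ k < finrank K L, y ≡ x * Fintype.card K ^ k [MOD n] → k = 0)
    (v : ℕ → L) : ∃ c : Fin n → K, ∀ y ∈ X, syndrome K n (α ^ y) c = v y := by
  classical
  have hαn : ∀ x, (α ^ x) ^ n = 1 := fun x => by
    rw [← pow_mul, mul_comm, pow_mul, hα.pow_eq_one, one_pow]
  have hn0 : 0 < n := Nat.pos_of_ne_zero (by rintro rfl; simp at hn)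
  have hα0 : α ≠ 0 := hα.ne_zero hn0.ne'
  refine ⟨∑ x ∈ X, traceWord K n ((n : L)⁻¹ * v x) (α ^ x)⁻¹, fun y hy => ?_⟩
  rw [map_sum, Finset.sum_eq_single y]
  · rw [syndrome_traceWord (hαn y) (by rw [inv_pow, hαn, inv_one]), Finset.sum_eq_single 0]
    · rw [if_pos (by rw [pow_zero, pow_one, inv_mul_cancel₀ (pow_ne_zero _ hα0)]), pow_zero,
        pow_one, mul_inv_cancel_left₀ hn]
    · intro k hk hk0
      rw [if_neg]
      intro h
      refine hk0 (hinj y hy y hy k (Finset.mem_range.1 hk) ?_)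
      rw [inv_pow, inv_mul_eq_one₀ (pow_ne_zero _ (pow_ne_zero _ hα0)), ← pow_mul] at h
      exact modEq_of_pow_eq_pow hα hn0 h.symm
    · intro h
      exact absurd (Finset.mem_range.2 finrank_pos) h
  · intro x hx hxy
    rw [syndrome_traceWord (hαn y) (by rw [inv_pow, hαn, inv_one])]
    refine Finset.sum_eq_zero fun k hk => if_neg fun h => ?_
    rw [inv_pow, inv_mul_eq_one₀ (pow_ne_zero _ (pow_ne_zero _ hα0)), ← pow_mul] at h
    have hmod : y ≡ x * Fintype.card K ^ k [MOD n] :=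
      modEq_of_pow_eq_pow hα hn0 h.symm
    have hk0 := hinj x hx y hy k (Finset.mem_range.1 hk) hmod
    rw [hk0, pow_zero, mul_one] at hmod
    exact hxy (hmod.eq_of_lt_of_lt (hX y hy) (hX x hx)).symm
  · exact fun h => absurd hy h

/-- The dimension of the BCH code: the syndromes at the coset representatives are independent. -/
theorem finrank_bchCode [Fintype K] [Finite L] (hα : IsPrimitiveRoot α n) (hn : (n : L) ≠ 0)
    (hm : finrank K L = m) (hQ : Fintype.card K = Q) (hδ : δ ≤ n)
    (hinj : ∀ x ∈ cosetReps Q δ, ∀ y ∈ cosetReps Q δ, ∀ k < m, y ≡ x * Q ^ k [MOD n] → k = 0) :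
    finrank K (bchCode K n Q m δ α) + m * (cosetReps Q δ).card = n := by
  have hn0 : 0 < n := Nat.pos_of_ne_zero (by rintro rfl; simp at hn)
  let Φ : (Fin n → K) →ₗ[K] (cosetReps Q δ → L) :=
    LinearMap.pi fun x => syndrome K n (α ^ (x : ℕ))
  have hker : LinearMap.ker Φ = bchCode K n Q m δ α := by
    ext c
    rw [mem_bchCode_iff_forall_cosetReps hα hn0 (hm ▸ finrank_pos) hQ, LinearMap.mem_ker]
    exact ⟨fun h x hx => congrFun h ⟨x, hx⟩, fun h => funext fun x => h x x.2⟩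
  have hrange : LinearMap.range Φ = ⊤ := by
    classical
    rw [LinearMap.range_eq_top]
    intro v
    obtain ⟨c, hc⟩ := exists_syndrome_eq (K := K) hα hn (cosetReps Q δ)
      (fun x hx => (mem_cosetReps.1 hx).1.2.trans_le hδ) (by rw [hQ, hm]; exact hinj)
      (fun x => if hx : x ∈ cosetReps Q δ then v ⟨x, hx⟩ else 0)
    exact ⟨c, funext fun x => (hc x x.2).trans (dif_pos x.2)⟩
  have h := LinearMap.finrank_range_add_finrank_ker Φ
  rw [hker, hrange, finrank_top, Module.finrank_pi_fintype, Finset.sum_const, Finset.card_univ,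
    Fintype.card_coe, hm, Module.finrank_fin_fun, smul_eq_mul] at h
  rw [add_comm, mul_comm]
  exact h

end Syndrome

/-! ### Hermitian duals -/

section HermitianDual

variable {K L : Type*} [Field K] [Field L] [Algebra K L] {n Q m δ : ℕ} {α : L}

/-- The words of the Hermitian dual vanish at `α^s` unless `-q s` lies in the defining set: they
are orthogonal to the trace words for `α^(q s)`, which then belong to the code. -/
theorem syndrome_eq_zero_of_mem_hermitianDual [Fintype K] [Finite L] (p r : ℕ) [Fact p.Prime]
    [CharP L p] (hα : IsPrimitiveRoot α n) (hn : 0 < n) (hm : finrank K L = m)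
    (hQ : Fintype.card K = Q) {y : Fin n → K}
    (hy : y ∈ hermitianDual (p ^ r) (bchCode K n Q m δ α : Set (Fin n → K))) (s : ℕ)
    (h : ∀ k < m, ∀ x, 1 ≤ x → x < δ → ¬ n ∣ s * p ^ r * Q ^ k + x) :
    syndrome K n (α ^ s) y = 0 := by
  classical
  have hαn : ∀ x, (α ^ x) ^ n = 1 := fun x => by
    rw [← pow_mul, mul_comm, pow_mul, hα.pow_eq_one, one_pow]
  have hmem : ∀ κ : L, traceWord K n κ (α ^ (s * p ^ r)) ∈ bchCode K n Q m δ α := by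
    intro κ
    rw [mem_bchCode_iff hα hn (hm ▸ finrank_pos) hQ]
    intro x hx hx'
    rw [syndrome_traceWord (hαn _) (hαn _)]
    refine Finset.sum_eq_zero fun k hk => if_neg fun h1 => ?_
    rw [← pow_mul, ← pow_add, hQ] at h1
    exact h k (hm ▸ Finset.mem_range.1 hk) x hx hx' (hα.dvd_of_pow_eq_one _ h1)
  have hzero : syndrome K n (α ^ (s * p ^ r)) (fun i => y i ^ p ^ r) = 0 := by
    apply (traceForm_nondegenerate K L).1
    intro κ
    rw [Algebra.traceForm_apply, syndrome_apply, Finset.sum_mul, map_sum]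
    rw [← hy _ (hmem κ)]
    refine Finset.sum_congr rfl fun i _ => ?_
    rw [smul_mul_assoc, map_smul, smul_eq_mul, traceWord, mul_comm κ]
  have hpow : syndrome K n (α ^ s) y ^ p ^ r = 0 := by
    rw [← hzero, syndrome_apply, syndrome_apply, sum_pow_char_pow]
    refine Finset.sum_congr rfl fun i _ => ?_
    rw [smul_pow, ← pow_mul, ← pow_mul, ← pow_mul]
    congr 2
    ring
  exact eq_zero_of_pow_eq_zero hpow

/-- The words of the Hermitian dual vanish at `1, α, …, α^(δ_max - 1)`. -/
theorem syndrome_eq_zero_of_lt_deltaMax {q : ℕ} [Fintype K] [Finite L] (p r : ℕ) [Fact p.Prime]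
    [CharP L p] (hq : q = p ^ r) (hα : IsPrimitiveRoot α n) (hn : n = q ^ (2 * m) - 1) (hn0 : 0 < n)
    (hm : finrank K L = m) (hQ : Fintype.card K = q ^ 2) (hδ : 2 ≤ δ) (hδ' : δ ≤ q ^ m - 1)
    {y : Fin n → K}
    (hy : y ∈ hermitianDual q (bchCode K n (q ^ 2) m δ α : Set (Fin n → K))) (s : ℕ)
    (hs : (s : ℤ) < deltaMax q m) : syndrome K n (α ^ s) y = 0 := by
  have hq1 := one_lt_of_le_pow_sub_one hδ hδ'
  have hm1 : 1 ≤ m := hm ▸ finrank_pos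
  subst hq
  refine syndrome_eq_zero_of_mem_hermitianDual p r hα hn0 hm hQ hy s fun k hk x hx hx' h => ?_
  set q := p ^ r
  -- multiplication by `q^(2m(k+1) - (2k+1))` moves the power of `q` from `s` to `x`
  have hle : 2 * k + 1 ≤ 2 * m * (k + 1) := by nlinarith
  have hodd : Odd (2 * m * (k + 1) - (2 * k + 1)) := by
    rw [Nat.odd_sub hle]
    refine iff_of_false (Nat.not_odd_iff_even.2 ?_)
      (Nat.not_even_iff_odd.2 (odd_two_mul_add_one k))
    rw [mul_assoc]
    exact even_two_mul _
  refine not_dvd_add_mul_pow (j := 2 * m * (k + 1) - (2 * k + 1)) hq1 hx (by omega) hs hodd ?_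
  rw [← hn]
  have h1 := h.mul_right (q ^ (2 * m * (k + 1) - (2 * k + 1)))
  rw [add_mul] at h1
  refine (Nat.ModEq.dvd_iff (Nat.ModEq.add_right _ ?_) dvd_rfl).1 h1
  have h2 : s * q * (q ^ 2) ^ k * q ^ (2 * m * (k + 1) - (2 * k + 1)) =
      s * q ^ (2 * m * (k + 1)) := by
    rw [← pow_mul, mul_assoc s, ← pow_succ', mul_assoc, ← pow_add, Nat.add_sub_cancel' hle]
  rw [h2, hn]
  simpa using (pow_mul_modEq_one q m (k + 1) hq1).mul_left s

theorem le_deltaMax {q m δ : ℕ} (hδ : 2 ≤ δ) (hδ' : δ ≤ q ^ m - 1) :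
    (δ : ℤ) ≤ deltaMax q m := by
  have hq := one_lt_of_le_pow_sub_one hδ hδ'
  have h1 : (δ : ℤ) ≤ (q : ℤ) ^ m - 1 := by
    have : δ + 1 ≤ q ^ m := by omega
    zify at this
    linarith
  rw [deltaMax]
  split_ifs with he
  · have hm2 : 2 ≤ m := by
      rcases he with ⟨r, rfl⟩
      rcases Nat.eq_zero_or_pos r with rfl | hr
      · simp at hδ'; omega
      · omega
    have h2 : (q : ℤ) ^ 2 ≤ (q : ℤ) ^ m := pow_le_pow_right₀ (by exact_mod_cast hq.le) hm2
    have h3 : (2 : ℤ) ≤ q := by exact_mod_cast hq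
    rw [pow_succ]
    nlinarith
  · simpa using h1

/-- The words of the Hermitian dual vanish at all the zeros that define the code. -/
theorem hermitianDual_bchCode_subset {q : ℕ} [Fintype K] [Finite L] (p r : ℕ) [Fact p.Prime]
    [CharP L p] (hq : q = p ^ r) (hα : IsPrimitiveRoot α n) (hn : n = q ^ (2 * m) - 1) (hn0 : 0 < n)
    (hm : finrank K L = m) (hQ : Fintype.card K = q ^ 2) (hδ : 2 ≤ δ) (hδ' : δ ≤ q ^ m - 1) :
    hermitianDual q (bchCode K n (q ^ 2) m δ α : Set (Fin n → K)) ⊆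
      (bchCode K n (q ^ 2) m δ α : Set (Fin n → K)) := by
  intro y hy
  refine (mem_bchCode_iff hα hn0 (hm ▸ finrank_pos) hQ y).2 fun x _ hx' => ?_
  have hle := le_deltaMax hδ hδ'
  exact syndrome_eq_zero_of_lt_deltaMax p r hq hα hn hn0 hm hQ hδ hδ' hy x (by omega)

theorem deltaMax_lt_hammingNorm {q : ℕ} [Fintype K] [DecidableEq K] [Finite L] (p r : ℕ)
    [Fact p.Prime] [CharP L p] (hq : q = p ^ r) (hα : IsPrimitiveRoot α n)
    (hn : n = q ^ (2 * m) - 1) (hn0 : 0 < n) (hm : finrank K L = m)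
    (hQ : Fintype.card K = q ^ 2) (hδ : 2 ≤ δ) (hδ' : δ ≤ q ^ m - 1) {y : Fin n → K}
    (hy : y ∈ hermitianDual q (bchCode K n (q ^ 2) m δ α : Set (Fin n → K))) (hy0 : y ≠ 0) :
    deltaMax q m < hammingNorm y := by
  have hle := le_deltaMax hδ hδ'
  have := lt_hammingNorm_of_syndrome_eq_zero hα hy0 0 (deltaMax q m).toNat fun s hs => by
    rw [zero_add]
    exact syndrome_eq_zero_of_lt_deltaMax p r hq hα hn hn0 hm hQ hδ hδ' hy s (by omega)
  omega

theorem le_hammingNorm_of_mem_bchCode [Fintype K] [DecidableEq K] (hα : IsPrimitiveRoot α n)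
    (hn : 0 < n) (hm : 1 ≤ m) (hQ : Fintype.card K = Q) {c : Fin n → K}
    (hc : c ∈ bchCode K n Q m δ α) (hc0 : c ≠ 0) : δ ≤ hammingNorm c := by
  have := lt_hammingNorm_of_syndrome_eq_zero hα hc0 1 (δ - 1) fun s hs =>
    (mem_bchCode_iff hα hn hm hQ c).1 hc (1 + s) (by omega) (by omega)
  omega

theorem one_mem_bchCode [Fintype K] (hα : IsPrimitiveRoot α n) (hn : 0 < n) (hm : 1 ≤ m)
    (hQ : Fintype.card K = Q) (hδ : δ ≤ n) : (1 : Fin n → K) ∈ bchCode K n Q m δ α := by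
  classical
  rw [mem_bchCode_iff hα hn hm hQ]
  intro x hx hx'
  simp only [syndrome_apply, Pi.one_apply, one_smul]
  rw [sum_pow_eq_ite (by rw [← pow_mul, mul_comm, pow_mul, hα.pow_eq_one, one_pow]), if_neg]
  exact hα.pow_ne_one_of_pos_of_lt (by omega) (by omega)

end HermitianDual

section Duality

variable {F K : Type*} [Field F] [Fintype F] [Field K] [Finite K] [Algebra F K] {n : ℕ}

/-- The dot product as a bilinear form. -/
def dotForm (K : Type*) [Field K] (n : ℕ) : LinearMap.BilinForm K (Fin n → K) :=
  LinearMap.mk₂ K (fun x y => x ⬝ᵥ y) add_dotProduct smul_dotProduct dotProduct_add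
    fun r x y => dotProduct_smul r x y

theorem dotForm_isRefl (K : Type*) [Field K] (n : ℕ) : (dotForm K n).IsRefl := by
  intro x y h
  change y ⬝ᵥ x = 0
  rw [dotProduct_comm]
  exact h

theorem dotForm_nondegenerate (K : Type*) [Field K] (n : ℕ) : (dotForm K n).Nondegenerate :=
  (dotForm_isRefl K n).nondegenerate_iff_separatingLeft.2
    fun x h => dotProduct_eq_zero x fun y => h y

/-- The entrywise conjugation `x ↦ x^q` of words. -/
noncomputable def conjWord (F : Type*) {K : Type*} [Field F] [Fintype F] [Field K] [Finite K]
    [Algebra F K] (n : ℕ) : (Fin n → K) ≃ (Fin n → K) :=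
  Equiv.piCongrRight fun _ => (FiniteField.frobeniusAlgEquivOfAlgebraic F K).toEquiv

theorem conjWord_apply (y : Fin n → K) (i : Fin n) :
    conjWord F n y i = y i ^ Fintype.card F :=
  rfl

theorem mem_hermitianDual_iff (C : Submodule K (Fin n → K)) (y : Fin n → K) :
    y ∈ hermitianDual (Fintype.card F) (C : Set (Fin n → K)) ↔
      conjWord F n y ∈ (dotForm K n).orthogonal C := by
  rw [LinearMap.BilinForm.mem_orthogonal_iff]
  refine forall₂_congr fun x _ => ?_
  change _ ↔ x ⬝ᵥ conjWord F n y = 0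
  rw [dotProduct_comm]
  rfl

/-- The Hermitian dual as a subspace. -/
noncomputable def hermitianDualSubmodule (F : Type*) {K : Type*} [Field F] [Fintype F] [Field K]
    [Finite K] [Algebra F K] {n : ℕ} (C : Submodule K (Fin n → K)) : Submodule K (Fin n → K) where
  carrier := hermitianDual (Fintype.card F) (C : Set (Fin n → K))
  zero_mem' := by
    intro x _
    simp [Fintype.card_ne_zero]
  add_mem' := by
    intro y z hy hz
    rw [mem_hermitianDual_iff] at *
    have h : conjWord F n (y + z) = conjWord F n y + conjWord F n z :=
      funext fun i => map_add (FiniteField.frobeniusAlgEquivOfAlgebraic F K) (y i) (z i)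
    rw [h]
    exact Submodule.add_mem _ hy hz
  smul_mem' := by
    intro r y hy
    rw [mem_hermitianDual_iff] at *
    have h : conjWord F n (r • y) = r ^ Fintype.card F • conjWord F n y :=
      funext fun i => map_mul (FiniteField.frobeniusAlgEquivOfAlgebraic F K) r (y i)
    rw [h]
    exact Submodule.smul_mem _ _ hy

theorem card_hermitianDualSubmodule (C : Submodule K (Fin n → K)) :
    Nat.card (hermitianDualSubmodule F C) = Nat.card K ^ (n - finrank K C) := by
  have h : Nat.card (hermitianDualSubmodule F C) = Nat.card ((dotForm K n).orthogonal C) :=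
    Nat.card_congr ((conjWord F n).subtypeEquiv fun y => mem_hermitianDual_iff C y)
  rw [h, Module.natCard_eq_pow_finrank (K := K),
    LinearMap.BilinForm.finrank_orthogonal (dotForm_nondegenerate K n), Module.finrank_fin_fun]

/-- The Hermitian bidual of a code is the code itself. -/
theorem mem_iff_forall_hermitianDual (C : Submodule K (Fin n → K)) (u : Fin n → K) :
    u ∈ C ↔ ∀ v ∈ hermitianDual (Fintype.card F) (C : Set (Fin n → K)),
      u ⬝ᵥ conjWord F n v = 0 := by
  conv_lhs => rw [← LinearMap.BilinForm.orthogonal_orthogonal (dotForm_nondegenerate K n)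
    (dotForm_isRefl K n) C]
  rw [LinearMap.BilinForm.mem_orthogonal_iff]
  constructor
  · intro h v hv
    rw [dotProduct_comm]
    exact h _ ((mem_hermitianDual_iff C v).1 hv)
  · intro h w hw
    have := h ((conjWord F n).symm w) ((mem_hermitianDual_iff C _).2 (by simpa using hw))
    rw [Equiv.apply_symm_apply, dotProduct_comm] at this
    exact this

end Duality

/-! ### The Hermitian construction -/

section HermitianConstruction

variable {F K : Type*} [Field F] [Fintype F] [Field K] [Algebra F K] {n : ℕ} {β : K}

/-- The word `β a + β^q b` over `K` for a pair `(a, b)` of words over `F`. -/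
def pairWord (F : Type*) {K : Type*} [Field F] [Fintype F] [Field K] [Algebra F K] (n : ℕ) (β : K) :
    (Fin n → F) × (Fin n → F) →ₗ[F] (Fin n → K) where
  toFun d i := β * algebraMap F K (d.1 i) + β ^ Fintype.card F * algebraMap F K (d.2 i)
  map_add' d e := by
    ext i
    simp only [Prod.fst_add, Prod.snd_add, Pi.add_apply, map_add]
    ring
  map_smul' r d := by
    ext i
    simp only [Prod.smul_fst, Prod.smul_snd, Pi.smul_apply, smul_eq_mul, map_mul,
      RingHom.id_apply]
    rw [Algebra.smul_def]
    ring

theorem pairWord_apply (d : (Fin n → F) × (Fin n → F)) (i : Fin n) :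
    pairWord F n β d i =
      β * algebraMap F K (d.1 i) + β ^ Fintype.card F * algebraMap F K (d.2 i) :=
  rfl

theorem pairWord_apply_eq_zero_iff (hβ : LinearIndependent F ![β, β ^ Fintype.card F])
    (d : (Fin n → F) × (Fin n → F)) (i : Fin n) :
    pairWord F n β d i = 0 ↔ d.1 i = 0 ∧ d.2 i = 0 := by
  constructor
  · intro h
    refine LinearIndependent.pair_iff.1 hβ _ _ ?_
    rw [Algebra.smul_def, Algebra.smul_def, mul_comm, mul_comm (algebraMap F K _)]
    exact h
  · rintro ⟨h1, h2⟩
    simp [pairWord_apply, h1, h2]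

theorem hammingNorm_pairWord [DecidableEq F] [DecidableEq K]
    (hβ : LinearIndependent F ![β, β ^ Fintype.card F]) (a b : Fin n → F) :
    hammingNorm (pairWord F n β (a, b)) = errorWeight a b := by
  refine congrArg Finset.card (Finset.filter_congr fun i _ => not_congr ?_)
  rw [pairWord_apply_eq_zero_iff hβ, Prod.mk_eq_zero]

theorem sq_sub_sq_ne_zero_of_linearIndependent (hβ : LinearIndependent F ![β, β ^ Fintype.card F]) :
    β ^ 2 - (β ^ Fintype.card F) ^ 2 ≠ 0 := by
  intro h
  rw [sq_sub_sq, mul_eq_zero] at h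
  rcases h with h | h
  · have := LinearIndependent.pair_iff.1 hβ 1 1 (by simpa using h)
    exact one_ne_zero this.1
  · have := LinearIndependent.pair_iff.1 hβ 1 (-1) (by simpa [sub_eq_add_neg] using h)
    exact one_ne_zero this.1

variable [Fintype K]

/-- A generator `β` of the multiplicative group gives a normal basis: `β^(q-1) ∈ F` would imply
`β^((q-1)^2) = 1`, although `β` has order `(q-1)(q+1)`. -/
theorem exists_linearIndependent_frobenius (hK : Fintype.card K = Fintype.card F ^ 2) :
    ∃ β : K, LinearIndependent F ![β, β ^ Fintype.card F] := by
  set q := Fintype.card F with hq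
  have hq1 : 1 < q := Fintype.one_lt_card
  obtain ⟨g, hg⟩ := IsCyclic.exists_generator (α := Kˣ)
  have hord : orderOf g = q ^ 2 - 1 := by
    rw [orderOf_eq_card_of_forall_mem_zpowers hg, Nat.card_units, Nat.card_eq_fintype_card, hK]
  refine ⟨g, LinearIndependent.pair_iff.2 fun s t h => ?_⟩
  have ht : t = 0 := by
    by_contra ht
    have h1 : (g : K) ^ (q - 1) = algebraMap F K (-s / t) := by
      apply mul_right_cancel₀ g.ne_zero
      rw [← pow_succ, Nat.sub_add_cancel hq1.le, map_div₀, map_neg]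
      have ht' : algebraMap F K t ≠ 0 := by simpa using ht
      rw [Algebra.smul_def, Algebra.smul_def] at h
      field_simp
      linear_combination h
    have h2 : (g : K) ^ ((q - 1) * (q - 1)) = 1 := by
      rw [pow_mul, h1, ← map_pow, FiniteField.pow_card_sub_one_eq_one, map_one]
      intro h0
      rw [h0, map_zero] at h1
      exact pow_ne_zero _ g.ne_zero h1
    have h3 : q ^ 2 - 1 ∣ (q - 1) * (q - 1) := by
      rw [← hord]
      exact orderOf_dvd_of_pow_eq_one (Units.ext (by simpa using h2))
    have h4 : q ^ 2 - 1 = (q + 1) * (q - 1) := by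
      simpa using Nat.sq_sub_sq q 1
    rw [h4] at h3
    have h5 := Nat.le_of_dvd (by omega) (Nat.dvd_of_mul_dvd_mul_right (by omega) h3)
    omega
  rw [ht, zero_smul, add_zero] at h
  exact ⟨(smul_eq_zero.1 h).resolve_right g.ne_zero, ht⟩

theorem pairWord_bijective (hK : Fintype.card K = Fintype.card F ^ 2)
    (hβ : LinearIndependent F ![β, β ^ Fintype.card F]) :
    Function.Bijective (pairWord F n β) := by
  classical
  rw [Fintype.bijective_iff_injective_and_card]
  constructor
  · rw [injective_iff_map_eq_zero]
    intro d hd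
    have h := fun i => (pairWord_apply_eq_zero_iff hβ d i).1 (congrFun hd i)
    exact Prod.ext (funext fun i => (h i).1) (funext fun i => (h i).2)
  · rw [Fintype.card_prod, Fintype.card_fun, Fintype.card_fun, Fintype.card_fin, hK, ← pow_mul,
      ← pow_add, two_mul]

/-- The skew-Hermitian part of the Hermitian product of `β a + β^q b` and `β a' + β^q b'` is a
multiple of the symplectic product of `(a, b)` and `(a', b')`. -/
theorem dotProduct_conjWord_sub (hK : Fintype.card K = Fintype.card F ^ 2)
    (d e : (Fin n → F) × (Fin n → F)) :
    pairWord F n β d ⬝ᵥ conjWord F n (pairWord F n β e) -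
        (pairWord F n β d ⬝ᵥ conjWord F n (pairWord F n β e)) ^ Fintype.card F =
      (β ^ 2 - (β ^ Fintype.card F) ^ 2) *
        algebraMap F K (e.2 ⬝ᵥ d.1 - d.2 ⬝ᵥ e.1) := by
  have hconj : ∀ d : (Fin n → F) × (Fin n → F), ∀ i, pairWord F n β d i ^ Fintype.card F =
      β ^ Fintype.card F * algebraMap F K (d.1 i) + β * algebraMap F K (d.2 i) := by
    intro d i
    have h2 : (β ^ Fintype.card F) ^ Fintype.card F = β := by
      rw [← pow_mul, ← pow_two, ← hK, FiniteField.pow_card]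
    have h := (map_add (FiniteField.frobeniusAlgHom F K) (β * algebraMap F K (d.1 i))
      (β ^ Fintype.card F * algebraMap F K (d.2 i)))
    simp only [FiniteField.frobeniusAlgHom_apply, mul_pow, ← map_pow, FiniteField.pow_card,
      h2] at h
    exact h
  have hpow : (pairWord F n β d ⬝ᵥ conjWord F n (pairWord F n β e)) ^ Fintype.card F =
      conjWord F n (pairWord F n β d) ⬝ᵥ pairWord F n β e := by
    change FiniteField.frobeniusAlgHom F K (∑ i, _) = ∑ i, _
    rw [map_sum]
    refine Finset.sum_congr rfl fun i _ => ?_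
    rw [map_mul, FiniteField.frobeniusAlgHom_apply, FiniteField.frobeniusAlgHom_apply,
      conjWord_apply, conjWord_apply, ← pow_mul, ← pow_two, ← hK, FiniteField.pow_card]
  rw [hpow]
  simp only [dotProduct, conjWord_apply, hconj, map_sub, map_sum, map_mul]
  rw [← Finset.sum_sub_distrib, ← Finset.sum_sub_distrib, Finset.mul_sum]
  refine Finset.sum_congr rfl fun i _ => ?_
  rw [pairWord_apply, pairWord_apply]
  ring

/-- The labels `(a, b)` for which `β a + β^q b` lies in the Hermitian dual of `C`. -/
noncomputable def hermitianLabels (F : Type*) {K : Type*} [Field F] [Fintype F] [Field K]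
    [Fintype K] [Algebra F K] {n : ℕ} (β : K) (C : Submodule K (Fin n → K)) :
    AddSubgroup ((Fin n → F) × (Fin n → F)) :=
  (hermitianDualSubmodule F C).toAddSubgroup.comap (pairWord F n β).toAddMonoidHom

theorem mem_hermitianLabels {C : Submodule K (Fin n → K)} {d : (Fin n → F) × (Fin n → F)} :
    d ∈ hermitianLabels F β C ↔
      pairWord F n β d ∈ hermitianDual (Fintype.card F) (C : Set (Fin n → K)) :=
  Iff.rfl

theorem card_hermitianLabels (hK : Fintype.card K = Fintype.card F ^ 2)
    (hβ : LinearIndependent F ![β, β ^ Fintype.card F]) (C : Submodule K (Fin n → K)) :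
    Nat.card (hermitianLabels F β C) = Fintype.card F ^ (2 * (n - finrank K C)) := by
  have h : Nat.card (hermitianLabels F β C) = Nat.card (hermitianDualSubmodule F C) :=
    Nat.card_congr ((Equiv.ofBijective _ (pairWord_bijective hK hβ)).subtypeEquiv
      fun _ => mem_hermitianLabels)
  rw [h, card_hermitianDualSubmodule, Nat.card_eq_fintype_card, hK, ← pow_mul]

/-- The symplectic complement of the labels of the Hermitian dual of `C` consists of the labels of
`C`. As the Hermitian dual is linear over `K`, orthogonality for the trace-symplectic form of `F`
is the same as orthogonality for the Hermitian form. -/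
theorem isOrthogonalTo_hermitianLabels_iff (p : ℕ) [Fact p.Prime] [Algebra (ZMod p) F]
    (hK : Fintype.card K = Fintype.card F ^ 2)
    (hβ : LinearIndependent F ![β, β ^ Fintype.card F]) (C : Submodule K (Fin n → K))
    (a b : Fin n → F) :
    IsOrthogonalTo p (hermitianLabels F β C) a b ↔ pairWord F n β (a, b) ∈ C := by
  have hne := sq_sub_sq_ne_zero_of_linearIndependent hβ
  rw [mem_iff_forall_hermitianDual (F := F)]
  constructor
  · intro h
    -- the product with any word of the dual is fixed by conjugation
    have hfix : ∀ v ∈ hermitianDual (Fintype.card F) (C : Set (Fin n → K)),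
        (pairWord F n β (a, b) ⬝ᵥ conjWord F n v) ^ Fintype.card F =
          pairWord F n β (a, b) ⬝ᵥ conjWord F n v := by
      intro v hv
      obtain ⟨d, rfl⟩ := (pairWord_bijective hK hβ).2 v
      have hsymp : d.2 ⬝ᵥ a - b ⬝ᵥ d.1 = 0 := by
        refine eq_zero_of_forall_phase_mul p fun t => ?_
        have htd : t • d ∈ hermitianLabels F β C := by
          rw [mem_hermitianLabels, map_smul, ← algebraMap_smul K t]
          exact (hermitianDualSubmodule F C).smul_mem _ hv
        have ht := h _ htd
        rw [Prod.smul_snd, Prod.smul_fst, smul_dotProduct, dotProduct_smul, smul_eq_mul,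
          smul_eq_mul] at ht
        apply mul_right_cancel₀ (phase_ne_zero p (t * (b ⬝ᵥ d.1)))
        rw [← phase_add, one_mul, ← ht]
        congr 1
        ring
      have h1 := dotProduct_conjWord_sub (β := β) hK (a, b) d
      rw [hsymp, map_zero, mul_zero, sub_eq_zero] at h1
      exact h1.symm
    intro v hv
    by_contra h0
    -- since `κ v` lies in the dual as well, all elements of `K` are fixed by conjugation
    have hall : ∀ κ : K, (κ ^ Fintype.card F) ^ Fintype.card F = κ ^ Fintype.card F := by
      intro κ
      have h1 := hfix (κ • v) ((hermitianDualSubmodule F C).smul_mem κ hv)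
      have h2 : conjWord F n (κ • v) = κ ^ Fintype.card F • conjWord F n v :=
        funext fun i => mul_pow κ (v i) _
      rw [h2, dotProduct_smul, smul_eq_mul, mul_pow, hfix v hv] at h1
      exact mul_right_cancel₀ h0 h1
    have h3 := hall β
    rw [← pow_mul, ← pow_two, ← hK, FiniteField.pow_card] at h3
    exact hne (by rw [← h3, sub_self])
  · intro h d hd
    have h1 := dotProduct_conjWord_sub (β := β) hK (a, b) d
    rw [h _ (mem_hermitianLabels.1 hd), zero_pow Fintype.card_ne_zero, sub_zero, eq_comm,
      mul_eq_zero, or_iff_right hne, map_eq_zero, sub_eq_zero] at h1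
    rw [h1]

theorem isIsotropic_hermitianLabels (p : ℕ) [Fact p.Prime] [Algebra (ZMod p) F]
    (hK : Fintype.card K = Fintype.card F ^ 2)
    (hβ : LinearIndependent F ![β, β ^ Fintype.card F]) {C : Submodule K (Fin n → K)}
    (hC : hermitianDual (Fintype.card F) (C : Set (Fin n → K)) ⊆ C) :
    IsIsotropic p (hermitianLabels F β C) := by
  intro d hd e he
  exact (isOrthogonalTo_hermitianLabels_iff p hK hβ C e.1 e.2).2 (hC he) d hd

/-- The Hermitian construction: a code that strictly contains its Hermitian dual gives a stabilizer
code. Its minimum distance is the least weight of the words of the code outside of the dual. -/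
theorem exists_hermitianConstruction (p : ℕ) [Fact p.Prime] [DecidableEq F] [DecidableEq K]
    [Algebra (ZMod p) F] (hK : Fintype.card K = Fintype.card F ^ 2) (C : Submodule K (Fin n → K))
    (hC : hermitianDual (Fintype.card F) (C : Set (Fin n → K)) ⊆ C)
    (hne : ∃ u ∈ C, u ∉ hermitianDual (Fintype.card F) (C : Set (Fin n → K))) :
    ∃ (Q : Submodule ℂ (StateSpace F n)) (k dQ : ℕ), k + 2 * (n - finrank K C) = n ∧
      HasParameters p Q k dQ ∧
      IsLeast {w | ∃ u ∈ C, u ∉ hermitianDual (Fintype.card F) (C : Set (Fin n → K)) ∧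
        hammingNorm u = w} dQ ∧
      (∀ t : ℤ, (∀ u ∈ hermitianDual (Fintype.card F) (C : Set (Fin n → K)), u ≠ 0 →
        t ≤ hammingNorm u) → IsPureUpTo p Q t) ∧
      IsHermitianConstruction p Q (C : Set (Fin n → K)) := by
  obtain ⟨β, hβ⟩ := exists_linearIndependent_frobenius hK
  obtain ⟨c, hc⟩ := (isIsotropic_hermitianLabels p hK hβ hC).exists_isPhaseLift
  have hcard := hc.finrank_mul_card
  rw [card_hermitianLabels hK hβ] at hcard
  have hle : 2 * (n - finrank K C) ≤ n :=
    (Nat.pow_dvd_pow_iff_le_right (Fintype.one_lt_card (α := F))).1 (Dvd.intro_left _ hcard)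
  have hleast : ∃ dQ, IsLeast {w | ∃ u ∈ C,
      u ∉ hermitianDual (Fintype.card F) (C : Set (Fin n → K)) ∧ hammingNorm u = w} dQ := by
    obtain ⟨u, hu, hu'⟩ := hne
    exact ⟨_, Nat.sInf_mem ⟨_, u, hu, hu', rfl⟩, fun w hw => Nat.sInf_le hw⟩
  obtain ⟨dQ, hdQ⟩ := hleast
  have hdetects : ∀ e, DetectsBelow p (fixedSpace p (hermitianLabels F β C) c) e ↔ e ≤ dQ := by
    intro e
    rw [hc.detectsBelow_iff]
    simp only [isOrthogonalTo_hermitianLabels_iff p hK hβ, mem_hermitianLabels]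
    constructor
    · intro h
      obtain ⟨u, hu, hu', hw⟩ := hdQ.1
      obtain ⟨⟨a, b⟩, rfl⟩ := (pairWord_bijective hK hβ).2 u
      rw [← hw, hammingNorm_pairWord hβ]
      exact h a b hu hu'
    · intro h a b hab hab'
      refine h.trans (hdQ.2 ⟨_, hab, hab', hammingNorm_pairWord hβ a b⟩)
  refine ⟨fixedSpace p (hermitianLabels F β C) c, n - 2 * (n - finrank K C), dQ,
    Nat.sub_add_cancel hle, ⟨hc.isStabilizerCode, ?_, (hdetects dQ).2 le_rfl,
      fun e he => (hdetects e).1 he⟩, hdQ, ?_, β, hβ, fun a b => ?_⟩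
  · apply Nat.eq_of_mul_eq_mul_right (pow_pos (Fintype.card_pos (α := F)) _)
    rw [hcard, ← pow_add, Nat.sub_add_cancel hle]
  · intro t ht r a b hr hab
    have hmem := hc.exists_smul_mem_stabilizer_iff.1 ⟨r, hr⟩
    rw [← hammingNorm_pairWord hβ]
    refine ht _ hmem fun h0 => ?_
    have h1 := (map_eq_zero_iff _ (pairWord_bijective hK hβ).1).1 h0
    rw [Prod.mk_eq_zero] at h1
    tauto
  · rw [hc.exists_smul_mem_stabilizer_iff]
    rfl

end HermitianConstruction

end QuantumBCH

theorem mainTheorem8 (p : ℕ) [Fact p.Prime] (q m δ n : ℕ)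
    {F K L : Type*} [Field F] [Fintype F] [DecidableEq F] [Algebra (ZMod p) F]
    [Field K] [Fintype K] [DecidableEq K] [Algebra F K]
    [Field L] [Fintype L] [Algebra K L]
    (hF : Fintype.card F = q) (hK : Fintype.card K = q ^ 2) (hL : Fintype.card L = q ^ (2 * m))
    (hm : 1 ≤ m) (hn : n = q ^ (2 * m) - 1)
    (hδ : 2 ≤ δ) (hδ' : δ ≤ q ^ m - 1)
    (α : L) (hα : IsPrimitiveRoot α n) :
    QuantumBCH.hermitianDual q (QuantumBCH.bchCode K n (q ^ 2) m δ α : Set (Fin n → K)) ⊆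
        (QuantumBCH.bchCode K n (q ^ 2) m δ α : Set (Fin n → K)) ∧
      ∃ (Q : Submodule ℂ (QuantumBCH.StateSpace F n)) (k dQ : ℕ),
        (k : ℤ) = (q : ℤ) ^ (2 * m) - 1
            - 2 * (m : ℤ) * ⌈((δ : ℚ) - 1) * (1 - 1 / (q : ℚ) ^ 2)⌉ ∧
        QuantumBCH.HasParameters p Q k dQ ∧
        δ ≤ dQ ∧
        QuantumBCH.IsPureUpTo p Q (QuantumBCH.deltaMax q m + 1) ∧
        QuantumBCH.IsHermitianConstruction p Q
          (QuantumBCH.bchCode K n (q ^ 2) m δ α : Set (Fin n → K)) ∧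
        ∀ d : ℕ, QuantumBCH.IsCodeMinDist
            (QuantumBCH.bchCode K n (q ^ 2) m δ α : Set (Fin n → K)) d →
          (d : ℤ) ≤ QuantumBCH.deltaMax q m →
          QuantumBCH.IsPureUpTo p Q dQ ∧ dQ = d := by
  open QuantumBCH in
  have hq1 := one_lt_of_le_pow_sub_one hδ hδ'
  have hqm : 2 * q ^ m ≤ q ^ (2 * m) := by
    rw [two_mul m, pow_add]
    exact Nat.mul_le_mul_right _ (by omega)
  have hn0 : 0 < n := by omega
  have hδn : δ ≤ n := by omega
  have : CharP F p := charP_of_injective_algebraMap (algebraMap (ZMod p) F).injective p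
  have : CharP K p := charP_of_injective_algebraMap (algebraMap F K).injective p
  have : CharP L p := charP_of_injective_algebraMap (algebraMap K L).injective p
  obtain ⟨r, -, hr⟩ := FiniteField.card F p
  rw [hF] at hr
  have hfin : Module.finrank K L = m := by
    have h := Module.card_eq_pow_finrank (K := K) (V := L)
    rw [hL, hK, ← pow_mul] at h
    have := Nat.pow_right_injective hq1 h
    omega
  have hnK : (n : K) = -1 := by
    have h0 : ((q ^ (2 * m) : ℕ) : K) = 0 := by
      rw [hr, ← pow_mul, Nat.cast_pow, CharP.cast_eq_zero, zero_pow]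
      exact Nat.mul_ne_zero r.pos.ne' (by omega)
    rw [hn, Nat.cast_sub (by omega), h0, Nat.cast_one, zero_sub]
  have hnL : (n : L) ≠ 0 := by
    rw [← map_natCast (algebraMap K L), hnK]
    simp
  set C := bchCode K n (q ^ 2) m δ α with hCdef
  have hdual : hermitianDual q (C : Set (Fin n → K)) ⊆ C :=
    hermitianDual_bchCode_subset p r hr hα hn hn0 hfin hK hδ hδ'
  have hweight : ∀ u ∈ hermitianDual q (C : Set (Fin n → K)), u ≠ 0 →
      deltaMax q m + 1 ≤ (hammingNorm u : ℤ) := fun u hu hu0 =>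
    Int.add_one_le_of_lt (deltaMax_lt_hammingNorm p r hr hα hn hn0 hfin hK hδ hδ' hu hu0)
  have hone : (1 : Fin n → K) ∈ C := one_mem_bchCode hα hn0 hm hK hδn
  -- the Hermitian square of the all-ones word is `n = -1`
  have hone' : (1 : Fin n → K) ∉ hermitianDual q (C : Set (Fin n → K)) := by
    intro h
    have h1 := h 1 hone
    simp [hnK] at h1
  have hdim : Module.finrank K C + m * (cosetReps (q ^ 2) δ).card = n := by
    refine finrank_bchCode hα hnL hfin hK hδn fun x hx y hy k hk h => ?_
    rw [mem_cosetReps] at hx hy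
    rw [hn] at h
    exact eq_zero_of_modEq_mul_pow hq1 (by omega) (by omega) hx.2 hy.2 hk h
  refine ⟨hdual, ?_⟩
  subst hF
  obtain ⟨Q, k, dQ, hk, hpar, hdQ, hpure, hherm⟩ :=
    exists_hermitianConstruction p hK C hdual ⟨1, hone, hone'⟩
  refine ⟨Q, k, dQ, ?_, hpar, ?_, hpure _ hweight, hherm, fun d hd hdmax => ?_⟩
  · have h1 := card_cosetReps (Fintype.card F ^ 2) δ (by omega)
    rw [Nat.cast_pow] at h1
    rw [← h1]
    have h2 : n - Module.finrank K C = m * (cosetReps (Fintype.card F ^ 2) δ).card := by omega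
    rw [h2] at hk
    have h3 : n + 1 = Fintype.card F ^ (2 * m) := by omega
    zify at hk h3
    rw [← h3]
    linear_combination hk
  · obtain ⟨u, hu, hu', hw⟩ := hdQ.1
    rw [← hw]
    refine le_hammingNorm_of_mem_bchCode hα hn0 hm hK hu fun h0 => hu' ?_
    rw [h0]
    exact (hermitianDualSubmodule F C).zero_mem
  · have hd_eq : dQ = d := by
      apply le_antisymm
      · -- a word of minimum weight is too light for the Hermitian dual
        obtain ⟨x, hx, y, hy, hxy, hw⟩ := hd.1
        rw [hammingDist_eq_hammingNorm] at hw
        refine hdQ.2 ⟨_, C.add_mem (C.neg_mem hx) hy, fun h => ?_, hw⟩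
        have := hweight _ h fun h0 => hxy (neg_add_eq_zero.1 h0)
        omega
      · obtain ⟨u, hu, hu', hw⟩ := hdQ.1
        refine hd.2 ⟨u, hu, 0, C.zero_mem, fun h0 => hu' ?_, ?_⟩
        · rw [h0]
          exact (hermitianDualSubmodule F C).zero_mem
        · rw [hammingDist_zero_right, hw]
    refine ⟨hpure _ fun u hu hu0 => ?_, hd_eq⟩
    have := hweight u hu hu0
    omega
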